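/- Let $\mathcal P=\prod_{i=1}^d[\underline p_i,\overline p_i]\subset\mathbb R^d$ with $\underline p_i<\overline p_i$, and let $E,A:\mathcal P\to\mathbb R^{n\times n}$, $B:\mathcal P\to\mathbb R^{n\times m}$, $C:\mathcal P\to\mathbb R^{p\times n}$ be continuous such that, for every $\mathsf p\in\mathcal P$, $E(\mathsf p)$ is invertible and all eigenvalues of the pencil $\lambda E(\mathsf p)-A(\mathsf p)$ (the $\lambda\in\mathbb C$ with $\det(\lambda E(\mathsf p)-A(\mathsf p))=0$) have negative real part. Let $\hat e_i,\hat a_j,\hat b_k,\hat c_\ell:\mathcal P\to\mathbb R$ ($i\le q_{\hat E}$, $j\le q_{\hat A}$, $k\le q_{\hat B}$, $\ell\le q_{\hat C}$) be given continuous functions. For matrices $\hat E_i,\hat A_j\in\mathbb R^{r\times r}$, $\hat B_k\in\mathbb R^{r\times m}$, $\hat C_\ell\in\mathbb R^{p\times r}$ put $$\hat E(\mathsf p)=\sum_i\hat e_i(\mathsf p)\hat E_i,\quad \hat A(\mathsf p)=\sum_j\hat a_j(\mathsf p)\hat A_j,\quad \hat B(\mathsf p)=\sum_k\hat b_k(\mathsf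 p)\hat B_k,\quad \hat C(\mathsf p)=\sum_\ell\hat c_\ell(\mathsf p)\hat C_\ell,$$ and let $\mathcal R$ be the set of all tuples $\hat\Sigma=\big((\hat E_i),(\hat A_j),(\hat B_k),(\hat C_\ell)\big)$ such that, for every $\mathsf p\in\mathcal P$, $\hat E(\mathsf p)$ is invertible and all eigenvalues of $\lambda\hat E(\mathsf p)-\hat A(\mathsf p)$ have negative real part. Let $H(s;\mathsf p)=C(\mathsf p)(sE(\mathsf p)-A(\mathsf p))^{-1}B(\mathsf p)$, $\hat H(s;\mathsf p)=\hat C(\mathsf p)(s\hat E(\mathsf p)-\hat A(\mathsf p))^{-1}\hat B(\mathsf p)$, and $$\mathcal J(\hat\Sigma)=\|H-\hat H\|_{\mathcal H_2\otimes\mathcal L_2}^2=\int_{\mathcal P}\frac1{2\pi}\int_{-\infty}^\infty\|H(\mathbf i\omega;\mathsf p)-\hat H(\mathbf i\omega;\mathsf p)\|_{\mathrm F}^2\,d\omega\,d\mathsf p .$$ Theorem (Gradient). The set $\mathcal R$ is open, and $\mathcal J$ is finite and (jointly) Fréchet differentiable at every $\hat\Sigma\in\mathcal R$. For every $\hat\Sigma\in\mathcal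 R$ and $\mathsf p\in\mathcal P$ the equations $$\begin{aligned} 0&=A\tilde P\hat E^{\mathsf T}+E\tilde P\hat A^{\mathsf T}+B\hat B^{\mathsf T}, & 0&=\hat A\hat P\hat E^{\mathsf T}+\hat E\hat P\hat A^{\mathsf T}+\hat B\hat B^{\mathsf T},\\ 0&=A^{\mathsf T}\tilde Q\hat E+E^{\mathsf T}\tilde Q\hat A-C^{\mathsf T}\hat C, & 0&=\hat A^{\mathsf T}\hat Q\hat E+\hat E^{\mathsf T}\hat Q\hat A+\hat C^{\mathsf T}\hat C \end{aligned}$$ (all coefficients taken at $\mathsf p$) have unique solutions $\tilde P(\mathsf p),\tilde Q(\mathsf p)\in\mathbb R^{n\times r}$, $\hat P(\mathsf p),\hat Q(\mathsf p)\in\mathbb R^{r\times r}$, these depend continuously on $\mathsf p\in\mathcal P$, and the partial gradients of $\mathcal J$ with respect to the Frobenius inner product $\langle X,Y\rangle=\operatorname{tr}(X^{\mathsf T}Y)$ are $$\begin{aligned} \nabla_{\hat E_i}\mathcal J(\hat\Sigma)&=2\int_{\mathcal P}\hat e_i(\mathsf p)\big(\hat Q(\mathsf p)^{\mathsf T}\hat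 A(\mathsf p)\hat P(\mathsf p)+\tilde Q(\mathsf p)^{\mathsf T}A(\mathsf p)\tilde P(\mathsf p)\big)\,d\mathsf p, & i&\le q_{\hat E},\\ \nabla_{\hat A_j}\mathcal J(\hat\Sigma)&=2\int_{\mathcal P}\hat a_j(\mathsf p)\big(\hat Q(\mathsf p)^{\mathsf T}\hat E(\mathsf p)\hat P(\mathsf p)+\tilde Q(\mathsf p)^{\mathsf T}E(\mathsf p)\tilde P(\mathsf p)\big)\,d\mathsf p, & j&\le q_{\hat A},\\ \nabla_{\hat B_k}\mathcal J(\hat\Sigma)&=2\int_{\mathcal P}\hat b_k(\mathsf p)\big(\hat Q(\mathsf p)^{\mathsf T}\hat B(\mathsf p)+\tilde Q(\mathsf p)^{\mathsf T}B(\mathsf p)\big)\,d\mathsf p, & k&\le q_{\hat B},\\ \nabla_{\hat C_\ell}\mathcal J(\hat\Sigma)&=2\int_{\mathcal P}\hat c_\ell(\mathsf p)\big(\hat C(\mathsf p)\hat P(\mathsf p)-C(\mathsf p)\tilde P(\mathsf p)\big)\,d\mathsf p, & \ell&\le q_{\hat C}. \end{aligned}$$ -/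

import Mathlib

open MeasureTheory Matrix
open scoped ENNReal

noncomputable section

/-- The matrix-valued coefficient functions `(E, A, B, C)` of a parametric linear time-invariant
system with `d` real parameters, state dimension `n`, `m` inputs and `p` outputs. -/
structure ParamSystem (d n m p : ℕ) where
  E : (Fin d → ℝ) → Matrix (Fin n) (Fin n) ℝ
  A : (Fin d → ℝ) → Matrix (Fin n) (Fin n) ℝ
  B : (Fin d → ℝ) → Matrix (Fin n) (Fin m) ℝ
  C : (Fin d → ℝ) → Matrix (Fin p) (Fin n) ℝ

/-- The set of (complex) eigenvalues of the matrix pencil `lam * E - A`. -/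
def pencilEigenvalues {n : ℕ} (A E : Matrix (Fin n) (Fin n) ℝ) : Set ℂ :=
  {lam | (lam • E.map (fun x : ℝ => (x : ℂ)) - A.map (fun x : ℝ => (x : ℂ))).det = 0}

/-- All eigenvalues of the pencil lie in the open left half-plane. -/
def IsStablePencil {n : ℕ} (A E : Matrix (Fin n) (Fin n) ℝ) : Prop :=
  ∀ lam ∈ pencilEigenvalues A E, lam.re < 0

/-- The transfer function `C(x) (s E(x) - A(x))⁻¹ B(x)`. -/
def ParamSystem.transfer {d n m p : ℕ} (S : ParamSystem d n m p) (s : ℂ) (x : Fin d → ℝ) :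
    Matrix (Fin p) (Fin m) ℂ :=
  (S.C x).map (fun t : ℝ => (t : ℂ)) *
    (s • (S.E x).map (fun t : ℝ => (t : ℂ)) - (S.A x).map (fun t : ℝ => (t : ℂ)))⁻¹ *
    (S.B x).map (fun t : ℝ => (t : ℂ))

/-- The Hardy `H₂` norm `((2π)⁻¹ ∫ ‖G(iω)‖_F² dω)^(1/2)`, with values in `[0, ∞]`; the squared
Frobenius norm is written as the sum of the squared moduli of the entries. -/
def h2Norm {p m : ℕ} (G : ℂ → Matrix (Fin p) (Fin m) ℂ) : ℝ≥0∞ :=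
  (ENNReal.ofReal (1 / (2 * Real.pi)) *
    ∫⁻ ω : ℝ, ∑ i, ∑ j, ‖G (Complex.I * (ω : ℂ)) i j‖ₑ ^ 2) ^ (1 / 2 : ℝ)

/-- The `H₂ ⊗ L₂` norm over the parameter domain `K`, with values in `[0, ∞]`. -/
def h2l2Norm {d p m : ℕ} (K : Set (Fin d → ℝ))
    (G : ℂ → (Fin d → ℝ) → Matrix (Fin p) (Fin m) ℂ) : ℝ≥0∞ :=
  (∫⁻ x in K, h2Norm (fun s => G s x) ^ 2) ^ (1 / 2 : ℝ)

/-- The standing assumptions on the full-order model over the box `[lo, hi]`. -/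
structure FOMAssumptions {d n m p : ℕ} (lo hi : Fin d → ℝ) (S : ParamSystem d n m p) : Prop where
  nondegenerate : ∀ i, lo i < hi i
  invertible : ∀ x ∈ Set.Icc lo hi, IsUnit (S.E x)
  stable : ∀ x ∈ Set.Icc lo hi, IsStablePencil (S.A x) (S.E x)
  continuous_E : ContinuousOn S.E (Set.Icc lo hi)
  continuous_A : ContinuousOn S.A (Set.Icc lo hi)
  continuous_B : ContinuousOn S.B (Set.Icc lo hi)
  continuous_C : ContinuousOn S.C (Set.Icc lo hi)

/-- The scalar functions of a parameter-separable reduced-order model. -/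
structure ScalarFunctions (d qE qA qB qC : ℕ) where
  e : Fin qE → (Fin d → ℝ) → ℝ
  a : Fin qA → (Fin d → ℝ) → ℝ
  b : Fin qB → (Fin d → ℝ) → ℝ
  c : Fin qC → (Fin d → ℝ) → ℝ

/-- All scalar functions are continuous on `K`. -/
structure ScalarFunctions.ContinuousOn {d qE qA qB qC : ℕ} (φ : ScalarFunctions d qE qA qB qC)
    (K : Set (Fin d → ℝ)) : Prop where
  e : ∀ i, _root_.ContinuousOn (φ.e i) K
  a : ∀ j, _root_.ContinuousOn (φ.a j) K
  b : ∀ k, _root_.ContinuousOn (φ.b k) K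
  c : ∀ l, _root_.ContinuousOn (φ.c l) K

/-- Tuples of fixed coefficient matrices `((Ê_i), (Â_j), (B̂_k), (Ĉ_l))`, a finite-dimensional
real vector space with its usual (product) topology. -/
abbrev ROMCoeffs (r m p qE qA qB qC : ℕ) : Type :=
  (Fin qE → Matrix (Fin r) (Fin r) ℝ) × (Fin qA → Matrix (Fin r) (Fin r) ℝ) ×
    (Fin qB → Matrix (Fin r) (Fin m) ℝ) × (Fin qC → Matrix (Fin p) (Fin r) ℝ)

/-- The reduced-order model in parameter-separable form with given coefficient matrices. -/
def romSystem {d r m p qE qA qB qC : ℕ} (φ : ScalarFunctions d qE qA qB qC)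
    (θ : ROMCoeffs r m p qE qA qB qC) : ParamSystem d r m p where
  E x := ∑ i, φ.e i x • θ.1 i
  A x := ∑ j, φ.a j x • θ.2.1 j
  B x := ∑ k, φ.b k x • θ.2.2.1 k
  C x := ∑ l, φ.c l x • θ.2.2.2 l

/-- The admissible structured reduced-order models: `Ê(x)` is invertible and the pencil is stable
for every parameter `x` in `K`. -/
def admissibleROMs {d : ℕ} (r m p : ℕ) {qE qA qB qC : ℕ} (K : Set (Fin d → ℝ))
    (φ : ScalarFunctions d qE qA qB qC) : Set (ROMCoeffs r m p qE qA qB qC) :=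
  {θ | ∀ x ∈ K, IsUnit ((romSystem φ θ).E x) ∧
    IsStablePencil ((romSystem φ θ).A x) ((romSystem φ θ).E x)}

/-- The `H₂ ⊗ L₂` error between two systems with the same inputs and outputs. -/
def h2l2Error {d n r m p : ℕ} (K : Set (Fin d → ℝ)) (S : ParamSystem d n m p)
    (R : ParamSystem d r m p) : ℝ≥0∞ :=
  h2l2Norm K (fun s x => S.transfer s x - R.transfer s x)

/-- The squared `H₂ ⊗ L₂` error as a real function of the coefficient matrices of the reduced-order
model. -/
def sqError {d n r m p qE qA qB qC : ℕ} (K : Set (Fin d → ℝ)) (S : ParamSystem d n m p)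
    (φ : ScalarFunctions d qE qA qB qC) (θ : ROMCoeffs r m p qE qA qB qC) : ℝ :=
  (h2l2Error K S (romSystem φ θ) ^ 2).toReal

/-- `f` is Fréchet differentiable at `X` and `G` is its gradient there, that is, the Riesz
representative of the derivative for the Frobenius inner product `⟨G, H⟩ = tr(Gᵀ H)`. Matrices carry
their usual topology; as the space is finite-dimensional, differentiability does not depend on a
choice of norm. -/
def HasFrobeniusGradientAt {a b : ℕ} (f : Matrix (Fin a) (Fin b) ℝ → ℝ)
    (G X : Matrix (Fin a) (Fin b) ℝ) : Prop :=
  ∃ D : Matrix (Fin a) (Fin b) ℝ →L[ℝ] ℝ, HasFDerivAt f D X ∧ ∀ H, D H = (Gᵀ * H).trace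

/-- The entrywise Lebesgue integral of a matrix-valued function over `K`. -/
def matrixIntegral {d a b : ℕ} (K : Set (Fin d → ℝ))
    (M : (Fin d → ℝ) → Matrix (Fin a) (Fin b) ℝ) : Matrix (Fin a) (Fin b) ℝ :=
  Matrix.of fun i j => ∫ x in K, M x i j

section Gramians

variable {d n r m p : ℕ} (S : ParamSystem d n m p) (R : ParamSystem d r m p) (x : Fin d → ℝ)

/-- `X = P̃(x)`: `0 = A P̃ Êᵀ + E P̃ Âᵀ + B B̂ᵀ`. -/
def SolvesCtrlMixed (X : Matrix (Fin n) (Fin r) ℝ) : Prop :=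
  0 = S.A x * X * (R.E x)ᵀ + S.E x * X * (R.A x)ᵀ + S.B x * (R.B x)ᵀ

/-- `X = P̂(x)`: `0 = Â P̂ Êᵀ + Ê P̂ Âᵀ + B̂ B̂ᵀ`. -/
def SolvesCtrlReduced (X : Matrix (Fin r) (Fin r) ℝ) : Prop :=
  0 = R.A x * X * (R.E x)ᵀ + R.E x * X * (R.A x)ᵀ + R.B x * (R.B x)ᵀ

/-- `X = Q̃(x)`: `0 = Aᵀ Q̃ Ê + Eᵀ Q̃ Â - Cᵀ Ĉ`. -/
def SolvesObsMixed (X : Matrix (Fin n) (Fin r) ℝ) : Prop :=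
  0 = (S.A x)ᵀ * X * R.E x + (S.E x)ᵀ * X * R.A x - (S.C x)ᵀ * R.C x

/-- `X = Q̂(x)`: `0 = Âᵀ Q̂ Ê + Êᵀ Q̂ Â + Ĉᵀ Ĉ`. -/
def SolvesObsReduced (X : Matrix (Fin r) (Fin r) ℝ) : Prop :=
  0 = (R.A x)ᵀ * X * R.E x + (R.E x)ᵀ * X * R.A x + (R.C x)ᵀ * R.C x

end Gramians

end

noncomputable section

open Filter Topology ComplexConjugate

/-! The argument never differentiates a Gramian. Its analytic input is an integral formula on the
imaginary axis. For a stable pencil with invertible `E`, the symmetric integrals of `(iωE - A)⁻¹ E`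
over `[-T, T]` tend to `π I` (`IsRegularStable.tendsto_integral_resolvent_mul`). This follows from
Cauchy's theorem on growing squares, after subtracting `(z + 1)⁻¹ I` to make the integrand decay
quadratically. If `A X E'ᵀ + E X A'ᵀ + W = 0`, then `(iωE - A)⁻¹ W (iωE' - A')⁻ᴴ` splits into two
such resolvent terms, one on each side of `X`, so its integral is `2π X`
(`integral_resolvent_mul_resolvent`).

Three facts follow. The equation with `W = 0` has only the zero solution. Hence its Kronecker matrix
is invertible, so solutions exist, are unique and depend continuously on the data. And the squared
`H₂` distance is a combination of traces `tr(C P C'ᵀ)` of controllability Gramians.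

For the gradient, compare two reduced models exactly. Pairing the Sylvester equations for `P` with
an observability Gramian `Q` taken at the base model gives (`trace_mixed_sub`, `trace_reduced_sub`,
`sqDistAt_sub`) an identity, without remainder, of the form `f(θ') - f(θ) = ⟨G(θ'), θ' - θ⟩`, where
only `P` is evaluated at `θ'`. After integration over the parameter box, `G` is still continuous at
`θ`, so Carathéodory's criterion (`hasFDerivAt_of_sub_eq`) gives joint differentiability with
gradient `G(θ)`. At `θ' = θ` the symmetry of the reduced Gramians collapses `G(θ)` to the stated
formulas. -/

/-- The complexification of a real matrix. -/
abbrev cplx {a b : ℕ} (M : Matrix (Fin a) (Fin b) ℝ) : Matrix (Fin a) (Fin b) ℂ :=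
  M.map (fun t : ℝ => (t : ℂ))

/-! ### Stable pencils: openness and resolvent decay -/

/-- The pencil `lam * E - A` is regular with invertible `E`, and all its eigenvalues lie in the open
left half-plane. -/
def IsRegularStable {n : ℕ} (A E : Matrix (Fin n) (Fin n) ℝ) : Prop :=
  IsUnit E ∧ IsStablePencil A E

/-- The resolvent `(z E - A)⁻¹` of a matrix pencil. -/
def pencilResolvent {n : ℕ} (A E : Matrix (Fin n) (Fin n) ℝ) (z : ℂ) : Matrix (Fin n) (Fin n) ℂ :=
  (z • cplx E - cplx A)⁻¹

/-- The closed right half of the closed unit disc. -/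
def rightHalfDisc : Set ℂ := {z | 0 ≤ z.re} ∩ Metric.closedBall 0 1

lemma isCompact_rightHalfDisc : IsCompact rightHalfDisc :=
  (isCompact_closedBall 0 1).inter_left (isClosed_le continuous_const Complex.continuous_re)

lemma inv_mem_rightHalfDisc {z : ℂ} (hz : 0 ≤ z.re) (h1 : 1 ≤ ‖z‖) : z⁻¹ ∈ rightHalfDisc := by
  refine ⟨?_, ?_⟩
  · simp only [Set.mem_ofPred_eq, Complex.inv_re]
    exact div_nonneg hz (Complex.normSq_nonneg z)
  · simpa using inv_le_one_of_one_le₀ h1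

section Pencil

variable {n : ℕ} {A E : Matrix (Fin n) (Fin n) ℝ}

lemma det_cplx (M : Matrix (Fin n) (Fin n) ℝ) : (cplx M).det = (M.det : ℂ) :=
  (RingHom.map_det Complex.ofRealHom M).symm

lemma IsRegularStable.det_ne_zero (h : IsRegularStable A E) {z : ℂ} (hz : 0 ≤ z.re) :
    (z • cplx E - cplx A).det ≠ 0 := fun h0 => (h.2 z h0).not_ge hz

lemma pencil_eq_smul_reversed {z : ℂ} (hz : z ≠ 0) :
    z • cplx E - cplx A = z • (cplx E - z⁻¹ • cplx A) := by
  rw [smul_sub, smul_smul, mul_inv_cancel₀ hz, one_smul]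

/-- The inversion `z ↦ z⁻¹` carries the part of the closed right half-plane outside the unit disc
into the half-disc, where the reversed pencil `E - zA` takes over; invertibility of `E` is its value
at `z = 0`. Stability thus becomes nonvanishing of two determinants on a compact set, which yields
both openness and uniform bounds. -/
lemma isRegularStable_iff : IsRegularStable A E ↔ ∀ z ∈ rightHalfDisc,
    (z • cplx E - cplx A).det ≠ 0 ∧ (cplx E - z • cplx A).det ≠ 0 := by
  constructor
  · intro h z hz
    refine ⟨h.det_ne_zero hz.1, ?_⟩
    rcases eq_or_ne z 0 with rfl | h0
    · rw [zero_smul, sub_zero, det_cplx]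
      exact_mod_cast ((Matrix.isUnit_iff_isUnit_det E).1 h.1).ne_zero
    · have h2 : (z⁻¹ • cplx E - cplx A).det ≠ 0 := by
        apply h.det_ne_zero
        rw [Complex.inv_re]
        exact div_nonneg hz.1 (Complex.normSq_nonneg z)
      rw [pencil_eq_smul_reversed (inv_ne_zero h0), inv_inv, det_smul] at h2
      exact right_ne_zero_of_mul h2
  · intro h
    constructor
    · have := (h 0 (by simp [rightHalfDisc])).2
      rw [zero_smul, sub_zero, det_cplx] at this
      rw [Matrix.isUnit_iff_isUnit_det]
      exact isUnit_iff_ne_zero.2 (by exact_mod_cast this)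
    · intro z hz
      by_contra hre
      push Not at hre
      rcases le_total ‖z‖ 1 with h1 | h1
      · exact (h z ⟨hre, by simpa using h1⟩).1 hz
      · have h0 : z ≠ 0 := by rintro rfl; simp at h1; linarith
        have hz' : (z • cplx E - cplx A).det = 0 := hz
        rw [pencil_eq_smul_reversed h0, det_smul] at hz'
        exact (h _ (inv_mem_rightHalfDisc hre h1)).2
          ((mul_eq_zero.1 hz').resolve_left (pow_ne_zero _ h0))

lemma continuous_cplx {a b : ℕ} : Continuous (cplx : Matrix (Fin a) (Fin b) ℝ → _) :=
  continuous_id.matrix_map Complex.continuous_ofReal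

lemma isOpen_isRegularStable :
    IsOpen {q : Matrix (Fin n) (Fin n) ℝ × Matrix (Fin n) (Fin n) ℝ | IsRegularStable q.1 q.2} := by
  simp only [isRegularStable_iff]
  rw [isOpen_iff_mem_nhds]
  intro q hq
  refine isCompact_rightHalfDisc.eventually_forall_of_forall_eventually fun z hz => ?_
  have c1 : Continuous fun w : (Matrix (Fin n) (Fin n) ℝ × Matrix (Fin n) (Fin n) ℝ) × ℂ =>
      (w.2 • cplx w.1.2 - cplx w.1.1).det :=
    ((continuous_snd.smul (continuous_cplx.comp (by fun_prop))).sub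
      (continuous_cplx.comp (by fun_prop))).matrix_det
  have c2 : Continuous fun w : (Matrix (Fin n) (Fin n) ℝ × Matrix (Fin n) (Fin n) ℝ) × ℂ =>
      (cplx w.1.2 - w.2 • cplx w.1.1).det :=
    ((continuous_cplx.comp (by fun_prop)).sub
      (continuous_snd.smul (continuous_cplx.comp (by fun_prop)))).matrix_det
  exact (c1.continuousAt.eventually_ne (hq z hz).1).and (c2.continuousAt.eventually_ne (hq z hz).2)

lemma IsRegularStable.transpose (h : IsRegularStable A E) : IsRegularStable Aᵀ Eᵀ := by
  rw [isRegularStable_iff] at h ⊢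
  intro z hz
  rw [← det_transpose, ← det_transpose (cplx Eᵀ - _)]
  exact h z hz

lemma continuousAt_matrix_inv_of_det_ne_zero {𝕜 : Type*} [NormedField 𝕜] {ι : Type*} [Fintype ι]
    [DecidableEq ι] {M : Matrix ι ι 𝕜} (h : M.det ≠ 0) : ContinuousAt Inv.inv M := by
  apply continuousAt_matrix_inv
  rw [Ring.inverse_eq_inv']
  exact continuousAt_inv₀ h

lemma IsRegularStable.continuousAt_resolvent (h : IsRegularStable A E) {z : ℂ} (hz : 0 ≤ z.re) :
    ContinuousAt (pencilResolvent A E) z :=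
  ContinuousAt.comp (f := fun z : ℂ => z • cplx E - cplx A)
    (continuousAt_matrix_inv_of_det_ne_zero (h.det_ne_zero hz))
    (by fun_prop)

lemma differentiable_det {ι : Type*} [Fintype ι] [DecidableEq ι] {M : ℂ → Matrix ι ι ℂ}
    (hM : ∀ i j, Differentiable ℂ fun z => M z i j) : Differentiable ℂ fun z => (M z).det := by
  simp only [det_apply]
  exact Differentiable.fun_sum fun σ _ =>
    (Differentiable.fun_finsetProd fun i _ => hM _ _).const_smul _

/-- By Cramer's rule each entry is a polynomial in `z` divided by the nonvanishing determinant. -/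
lemma IsRegularStable.differentiableAt_resolvent (h : IsRegularStable A E) {z : ℂ} (hz : 0 ≤ z.re)
    (i j : Fin n) : DifferentiableAt ℂ (fun z => pencilResolvent A E z i j) z := by
  have hp : ∀ i j, Differentiable ℂ fun z : ℂ => (z • cplx E - cplx A) i j := by
    intro i j
    simp only [Matrix.sub_apply, Matrix.smul_apply, smul_eq_mul]
    fun_prop
  have e : (fun z => pencilResolvent A E z i j) = fun z : ℂ =>
      ((z • cplx E - cplx A).det)⁻¹ * (z • cplx E - cplx A).adjugate i j := by
    ext z
    rw [pencilResolvent, inv_def, Ring.inverse_eq_inv', Matrix.smul_apply, smul_eq_mul]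
  rw [e]
  refine ((differentiable_det hp z).inv (h.det_ne_zero hz)).mul ?_
  simp only [adjugate_apply]
  refine differentiable_det (fun k l => ?_) z
  simp only [updateRow_apply]
  split_ifs
  · exact differentiable_const _
  · exact hp k l

lemma pencilResolvent_eq_smul {z : ℂ} (hz : z ≠ 0) :
    pencilResolvent A E z = z⁻¹ • (cplx E - z⁻¹ • cplx A)⁻¹ := by
  have := (pencil_eq_smul_reversed (A := A) (E := E) hz)
  rw [pencilResolvent, this, inv_def, inv_def, det_smul, adjugate_smul, smul_smul, smul_smul,
    Ring.inverse_eq_inv', mul_inv, mul_assoc, mul_comm _ (z ^ _), ← mul_assoc]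
  -- The scalar power from the adjugate has exponent `card - 1`, a truncated subtraction, so the
  -- empty matrix is treated separately.
  rcases n with - | n
  · ext i; exact i.elim0
  · congr 2
    simp only [Fintype.card_fin, Nat.add_sub_cancel, pow_succ]
    field_simp

lemma exists_entry_bound {K : Set ℂ} (hK : IsCompact K) {M : ℂ → Matrix (Fin n) (Fin n) ℂ}
    (hM : ContinuousOn M K) : ∃ c : ℝ, ∀ z ∈ K, ∀ i j, ‖M z i j‖ ≤ c := by
  have : ∀ i j, ∃ c, ∀ z ∈ K, ‖M z i j‖ ≤ c := fun i j =>
    hK.exists_bound_of_continuousOn (f := fun z => M z i j)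
      ((continuous_apply_apply i j).comp_continuousOn hM)
  choose c hc using this
  refine ⟨∑ i, ∑ j, |c i j|, fun z hz i j => (hc i j z hz).trans ((le_abs_self _).trans ?_)⟩
  exact (Finset.single_le_sum (f := fun j => |c i j|) (fun _ _ => abs_nonneg _)
    (Finset.mem_univ j)).trans (Finset.single_le_sum (f := fun i => ∑ j, |c i j|)
      (fun _ _ => Finset.sum_nonneg fun _ _ => abs_nonneg _) (Finset.mem_univ i))

/-- Inside the unit disc the resolvent is bounded by compactness; outside it equals `z⁻¹` times the
inverse of the reversed pencil at `z⁻¹`, again bounded by compactness. The factor 2 dominates `1 +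
‖z‖` in the first case and `(1 + ‖z‖) / ‖z‖` in the second. -/
lemma IsRegularStable.exists_resolvent_bound (h : IsRegularStable A E) :
    ∃ c : ℝ, 0 ≤ c ∧ ∀ z : ℂ, 0 ≤ z.re → ∀ i j,
      (1 + ‖z‖) * ‖pencilResolvent A E z i j‖ ≤ c := by
  have h' := isRegularStable_iff.1 h
  obtain ⟨c1, hc1⟩ := exists_entry_bound isCompact_rightHalfDisc (M := pencilResolvent A E)
    fun z hz => (h.continuousAt_resolvent hz.1).continuousWithinAt
  obtain ⟨c2, hc2⟩ := exists_entry_bound isCompact_rightHalfDisc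
    (M := fun z => (cplx E - z • cplx A)⁻¹) fun z hz => (ContinuousAt.comp
      (f := fun z : ℂ => cplx E - z • cplx A)
      (continuousAt_matrix_inv_of_det_ne_zero (h' z hz).2) (by fun_prop)).continuousWithinAt
  refine ⟨2 * max 0 (max c1 c2), by positivity, fun z hz i j => ?_⟩
  rcases le_total ‖z‖ 1 with h1 | h1
  · have := hc1 z ⟨hz, by simpa using h1⟩ i j
    exact mul_le_mul (by linarith) (this.trans ((le_max_left _ _).trans (le_max_right _ _)))
      (norm_nonneg _) (by norm_num)
  · have h0 : z ≠ 0 := by rintro rfl; simp at h1; linarith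
    have := hc2 _ (inv_mem_rightHalfDisc hz h1) i j
    rw [pencilResolvent_eq_smul h0, Matrix.smul_apply, smul_eq_mul, norm_mul, ← mul_assoc, norm_inv]
    refine mul_le_mul ?_ (this.trans ((le_max_right _ _).trans (le_max_right _ _)))
      (norm_nonneg _) (by norm_num)
    rw [← div_eq_mul_inv, div_le_iff₀ (by linarith)]
    linarith

end Pencil

/-! ### Contour integrals along the imaginary axis -/

lemma tendsto_integral_imaginary_axis_zero {F : ℂ → ℂ} {c : ℝ}
    (hF : ∀ z : ℂ, 0 ≤ z.re → DifferentiableAt ℂ F z)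
    (hc : ∀ z : ℂ, 0 ≤ z.re → ‖z‖ ^ 2 * ‖F z‖ ≤ c) :
    Tendsto (fun T : ℝ => ∫ ω in -T..T, F (Complex.I * ω)) atTop (𝓝 0) := by
  -- Cauchy's theorem on `[0, T] × [-T, T]` moves the integral to the other three sides. Their total
  -- length is `4T`, and `‖F‖ ≤ c / T²` there.
  have key : ∀ T : ℝ, 0 < T → ‖∫ ω in -T..T, F (Complex.I * ω)‖ ≤ 4 * c / T := by
    intro T hT
    have hb : ∀ z : ℂ, 0 ≤ z.re → T ≤ ‖z‖ → ‖F z‖ ≤ c / T ^ 2 := by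
      intro z hz hTz
      rw [le_div_iff₀ (by positivity), mul_comm]
      exact (mul_le_mul_of_nonneg_right (pow_le_pow_left₀ hT.le hTz 2) (norm_nonneg _)).trans
        (hc z hz)
    have hre : ∀ z ∈ Set.uIcc 0 T ×ℂ Set.uIcc (-T) T, 0 ≤ z.re := by
      intro z hz
      have := hz.1
      rw [Set.uIcc_of_le hT.le] at this
      exact this.1
    have hre' : ∀ z ∈ Set.Ioo (min 0 T) (max 0 T) ×ℂ Set.Ioo (min (-T) T) (max (-T) T),
        0 ≤ z.re := by
      intro z hz
      have := hz.1.1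
      rw [min_eq_left hT.le] at this
      exact this.le
    have h := Complex.integral_boundary_rect_eq_zero_of_continuousOn_of_differentiableOn F
      (⟨0, -T⟩ : ℂ) (⟨T, T⟩ : ℂ)
      (fun z hz => (hF z (hre z hz)).continuousAt.continuousWithinAt)
      (fun z hz => (hF z (hre' z hz)).differentiableWithinAt)
    simp only [Complex.ofReal_zero, zero_add, smul_eq_mul] at h
    have e : ∫ ω in -T..T, F (Complex.I * ω) = ∫ ω in -T..T, F (ω * Complex.I) := by
      simp only [mul_comm]
    have b1 : ‖∫ x in (0 : ℝ)..T, F (x + ((-T : ℝ) : ℂ) * Complex.I)‖ ≤ c / T ^ 2 * |T - 0| := by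
      refine intervalIntegral.norm_integral_le_of_norm_le_const fun x hx => ?_
      rw [Set.uIoc_of_le hT.le] at hx
      refine hb _ (by simpa using hx.1.le) ?_
      have := Complex.abs_im_le_norm (x + ((-T : ℝ) : ℂ) * Complex.I)
      simpa [abs_of_pos hT] using this
    have b2 : ‖∫ x in (0 : ℝ)..T, F (x + (T : ℂ) * Complex.I)‖ ≤ c / T ^ 2 * |T - 0| := by
      refine intervalIntegral.norm_integral_le_of_norm_le_const fun x hx => ?_
      rw [Set.uIoc_of_le hT.le] at hx
      refine hb _ (by simpa using hx.1.le) ?_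
      have := Complex.abs_im_le_norm (x + (T : ℂ) * Complex.I)
      simpa [abs_of_pos hT] using this
    have b3 : ‖∫ y in (-T)..T, F (T + (y : ℂ) * Complex.I)‖ ≤ c / T ^ 2 * |T - -T| := by
      refine intervalIntegral.norm_integral_le_of_norm_le_const fun y _ => ?_
      refine hb _ (by simpa using hT.le) ?_
      have := Complex.abs_re_le_norm (T + (y : ℂ) * Complex.I)
      simpa [abs_of_pos hT] using this
    rw [e]
    set I1 := ∫ x in (0 : ℝ)..T, F (x + ((-T : ℝ) : ℂ) * Complex.I)
    set I2 := ∫ x in (0 : ℝ)..T, F (x + (T : ℂ) * Complex.I)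
    set I3 := ∫ y in (-T)..T, F (T + (y : ℂ) * Complex.I)
    set I0 := ∫ ω in -T..T, F (ω * Complex.I)
    have h4 : ‖I0‖ = ‖I1 - I2 + Complex.I * I3‖ := by
      rw [sub_eq_zero.1 h, norm_mul, Complex.norm_I, one_mul]
    rw [h4]
    have h5 : ‖I1 - I2 + Complex.I * I3‖ ≤ ‖I1‖ + ‖I2‖ + ‖I3‖ := by
      refine (norm_add_le _ _).trans (add_le_add (norm_sub_le _ _) ?_)
      rw [norm_mul, Complex.norm_I, one_mul]
    rw [sub_zero, abs_of_pos hT] at b1 b2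
    rw [sub_neg_eq_add, abs_of_pos (by linarith)] at b3
    have h6 : c / T ^ 2 * T + c / T ^ 2 * T + c / T ^ 2 * (T + T) = 4 * c / T := by
      field_simp; ring
    linarith
  exact squeeze_zero_norm' ((eventually_gt_atTop 0).mono key)
    (tendsto_const_nhds.div_atTop tendsto_id)

lemma I_mul_add_one_ne_zero (ω : ℝ) : Complex.I * ω + 1 ≠ 0 := fun h => by
  simpa using congrArg Complex.re h

lemma integral_inv_I_mul_add_one (T : ℝ) :
    ∫ ω in -T..T, (Complex.I * ω + 1)⁻¹ = ((2 * Real.arctan T : ℝ) : ℂ) := by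
  -- The imaginary part of this primitive is even in `ω`, so it cancels over the symmetric interval
  -- and only the arctangent survives.
  have hd : ∀ ω : ℝ, HasDerivAt (fun ω : ℝ => ((Real.arctan ω : ℝ) : ℂ) -
      Complex.I / 2 * ((Real.log (1 + ω ^ 2) : ℝ) : ℂ)) ((Complex.I * ω + 1)⁻¹) ω := by
    intro ω
    have hp : (1 : ℝ) + ω ^ 2 ≠ 0 := by positivity
    have h1 := (Real.hasDerivAt_arctan ω).ofReal_comp
    have h2 := ((((hasDerivAt_id ω).pow 2).const_add 1).log (by simpa using hp)).ofReal_comp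
    refine (h1.sub (h2.const_mul (Complex.I / 2))).congr_deriv ?_
    have hc : (1 : ℂ) + (ω : ℂ) ^ 2 ≠ 0 := by exact_mod_cast hp
    have hI := I_mul_add_one_ne_zero ω
    simp only [id, Pi.pow_apply]
    push_cast
    refine eq_inv_of_mul_eq_one_left ?_
    field_simp
    linear_combination (-(ω : ℂ) ^ 2) * Complex.I_sq
  rw [intervalIntegral.integral_eq_sub_of_hasDerivAt (fun ω _ => hd ω)]
  · simp only [Real.arctan_neg, neg_sq]
    push_cast
    ring
  · apply Continuous.intervalIntegrable
    exact Continuous.inv₀ (by fun_prop) I_mul_add_one_ne_zero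

lemma tendsto_integral_inv_I_mul_add_one :
    Tendsto (fun T : ℝ => ∫ ω in -T..T, (Complex.I * ω + 1)⁻¹) atTop (𝓝 (Real.pi : ℂ)) := by
  simp only [integral_inv_I_mul_add_one]
  have h := (Real.tendsto_arctan_atTop.mono_right nhdsWithin_le_nhds).const_mul 2
  rw [show (2 : ℝ) * (Real.pi / 2) = Real.pi by ring] at h
  exact (Complex.continuous_ofReal.tendsto _).comp h

/-! ### The symmetric integral of the resolvent -/

section Pencil

variable {n : ℕ} {A E : Matrix (Fin n) (Fin n) ℝ}

lemma IsRegularStable.resolvent_mul (h : IsRegularStable A E) {z : ℂ} (hz : 0 ≤ z.re) :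
    pencilResolvent A E z * (z • cplx E - cplx A) = 1 :=
  nonsing_inv_mul _ (isUnit_iff_ne_zero.2 (h.det_ne_zero hz))

lemma IsRegularStable.continuous_resolvent (h : IsRegularStable A E) :
    Continuous fun ω : ℝ => pencilResolvent A E (Complex.I * ω) :=
  continuous_iff_continuousAt.2 fun ω => ContinuousAt.comp (f := fun ω : ℝ => Complex.I * (ω : ℂ))
    (h.continuousAt_resolvent (by simp)) (by fun_prop)

lemma add_one_ne_zero_of_re_nonneg {z : ℂ} (hz : 0 ≤ z.re) : z + 1 ≠ 0 := fun h => by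
  have := congrArg Complex.re h
  simp at this
  linarith

/-- Writing the identity as `(zE - A)⁻¹ (zE - A)` cancels the leading terms in `z`. The right side
is a product of two factors of order `1/z`. -/
lemma IsRegularStable.resolvent_mul_sub (h : IsRegularStable A E) {z : ℂ} (hz : 0 ≤ z.re) :
    pencilResolvent A E z * cplx E - (z + 1)⁻¹ • (1 : Matrix (Fin n) (Fin n) ℂ) =
      (z + 1)⁻¹ • (pencilResolvent A E z * (cplx E + cplx A)) := by
  have h1 := add_one_ne_zero_of_re_nonneg hz
  rw [← h.resolvent_mul hz, ← smul_right_inj h1, smul_sub, smul_smul, smul_smul,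
    mul_inv_cancel₀ h1, one_smul, one_smul, ← Matrix.mul_smul, ← Matrix.mul_sub]
  congr 1
  rw [add_smul, one_smul]
  abel

/-- The integrand decays only like `1/ω`, so the limit is over symmetric intervals. Subtracting `(z
+ 1)⁻¹ I` leaves a quadratically decaying function, analytic on the right half-plane, that
contributes nothing; the subtracted scalar contributes `π`. -/
lemma IsRegularStable.tendsto_integral_resolvent_mul (h : IsRegularStable A E) (i j : Fin n) :
    Tendsto (fun T : ℝ => ∫ ω in -T..T, (pencilResolvent A E (Complex.I * ω) * cplx E) i j) atTop
      (𝓝 ((Real.pi : ℂ) * (1 : Matrix (Fin n) (Fin n) ℂ) i j)) := by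
  obtain ⟨c, hc0, hc⟩ := h.exists_resolvent_bound
  set F : ℂ → ℂ := fun z => (z + 1)⁻¹ * (pencilResolvent A E z * (cplx E + cplx A)) i j with hFdef
  have hF : ∀ z : ℂ, 0 ≤ z.re → DifferentiableAt ℂ F z := by
    intro z hz
    have h1 : DifferentiableAt ℂ (fun z : ℂ => (z + 1)⁻¹) z :=
      (differentiableAt_id.add_const (1 : ℂ)).inv (add_one_ne_zero_of_re_nonneg hz)
    refine h1.mul ?_
    simp only [Matrix.mul_apply]
    exact DifferentiableAt.fun_sum fun k _ => (h.differentiableAt_resolvent hz i k).mul_const _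
  have hcF : ∀ z : ℂ, 0 ≤ z.re → ‖z‖ ^ 2 * ‖F z‖ ≤ ∑ k, c * ‖(cplx E + cplx A) k j‖ := by
    intro z hz
    have h1 : ‖z‖ ≤ ‖z + 1‖ := by
      rw [Complex.norm_def, Complex.norm_def]
      apply Real.sqrt_le_sqrt
      simp only [Complex.normSq_apply, Complex.add_re, Complex.add_im, Complex.one_re,
        Complex.one_im]
      nlinarith
    have h2 : ‖z‖ * ‖(z + 1)⁻¹‖ ≤ 1 := by
      rw [norm_inv, ← div_eq_mul_inv]
      exact div_le_one_of_le₀ h1 (norm_nonneg _)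
    have h3 : ‖z‖ * ‖(pencilResolvent A E z * (cplx E + cplx A)) i j‖ ≤
        ∑ k, c * ‖(cplx E + cplx A) k j‖ := by
      rw [Matrix.mul_apply]
      refine (mul_le_mul_of_nonneg_left (norm_sum_le _ _) (norm_nonneg _)).trans ?_
      rw [Finset.mul_sum]
      refine Finset.sum_le_sum fun k _ => ?_
      rw [norm_mul, ← mul_assoc]
      refine mul_le_mul_of_nonneg_right (le_trans ?_ (hc z hz i k)) (norm_nonneg _)
      exact mul_le_mul_of_nonneg_right (by linarith) (norm_nonneg _)
    calc ‖z‖ ^ 2 * ‖F z‖ = (‖z‖ * ‖(z + 1)⁻¹‖) *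
          (‖z‖ * ‖(pencilResolvent A E z * (cplx E + cplx A)) i j‖) := by
          rw [hFdef, norm_mul]; ring
      _ ≤ 1 * (‖z‖ * ‖(pencilResolvent A E z * (cplx E + cplx A)) i j‖) :=
          mul_le_mul_of_nonneg_right h2 (by positivity)
      _ ≤ _ := by rw [one_mul]; exact h3
  have h0 := tendsto_integral_imaginary_axis_zero hF hcF
  have hadd := h0.add (tendsto_integral_inv_I_mul_add_one.mul_const
    ((1 : Matrix (Fin n) (Fin n) ℂ) i j))
  rw [zero_add] at hadd
  refine hadd.congr fun T => ?_
  rw [← intervalIntegral.integral_mul_const, ← intervalIntegral.integral_add]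
  · refine intervalIntegral.integral_congr fun ω _ => ?_
    have := congrFun (congrFun (h.resolvent_mul_sub (z := Complex.I * ω) (by simp)) i) j
    simp only [Matrix.sub_apply, Matrix.smul_apply, smul_eq_mul] at this
    simp only [hFdef]
    rw [← this]
    ring
  · apply Continuous.intervalIntegrable
    refine continuous_iff_continuousAt.2 fun ω => ?_
    exact ContinuousAt.comp (f := fun ω : ℝ => Complex.I * (ω : ℂ))
      (hF _ (by simp)).continuousAt (by fun_prop)
  · apply Continuous.intervalIntegrable
    exact (Continuous.inv₀ (by fun_prop) I_mul_add_one_ne_zero).mul continuous_const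

end Pencil

/-! ### Generalized Sylvester equations -/

section Sylvester

variable {n r : ℕ} {A E : Matrix (Fin n) (Fin n) ℝ} {A' E' : Matrix (Fin r) (Fin r) ℝ}

lemma cplx_mul {a b c : ℕ} (M : Matrix (Fin a) (Fin b) ℝ) (N : Matrix (Fin b) (Fin c) ℝ) :
    cplx (M * N) = cplx M * cplx N := Matrix.map_mul (f := Complex.ofRealHom)

lemma cplx_add {a b : ℕ} (M N : Matrix (Fin a) (Fin b) ℝ) :
    cplx (M + N) = cplx M + cplx N := by ext; simp

lemma cplx_neg {a b : ℕ} (M : Matrix (Fin a) (Fin b) ℝ) :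
    cplx (-M) = -cplx M := by ext; simp

lemma conjTranspose_cplx {a b : ℕ} (M : Matrix (Fin a) (Fin b) ℝ) :
    (cplx M)ᴴ = cplx Mᵀ := by ext; simp [conjTranspose_apply]

/-- On the imaginary axis the conjugate of `z` is `-z`, so `W = (zE - A) X E'ᴴ + E X (zE' - A')ᴴ`:
the terms in `z` cancel. Multiplying by the two resolvents removes one pencil from each summand. -/
lemma resolvent_mul_resolvent_of_sylvester (h : IsRegularStable A E) (h' : IsRegularStable A' E')
    {X W : Matrix (Fin n) (Fin r) ℝ} (hX : A * X * E'ᵀ + E * X * A'ᵀ + W = 0) (ω : ℝ) :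
    pencilResolvent A E (Complex.I * ω) * cplx W * (pencilResolvent A' E' (Complex.I * ω))ᴴ =
      cplx X * (pencilResolvent A' E' (Complex.I * ω) * cplx E')ᴴ +
        pencilResolvent A E (Complex.I * ω) * cplx E * cplx X := by
  set z := Complex.I * (ω : ℂ) with hz
  have hz0 : 0 ≤ z.re := by simp [hz]
  have hzc : star z = -z := by simp [hz]
  have hW : cplx W = (z • cplx E - cplx A) * cplx X * (cplx E')ᴴ +
      cplx E * cplx X * (z • cplx E' - cplx A')ᴴ := by
    rw [eq_neg_of_add_eq_zero_right hX]
    simp only [conjTranspose_sub, conjTranspose_smul, conjTranspose_cplx, cplx_neg, cplx_add,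
      cplx_mul, hzc, Matrix.sub_mul, Matrix.mul_sub, Matrix.smul_mul, Matrix.mul_smul, neg_smul,
      Matrix.mul_neg]
    abel
  have h1 := h.resolvent_mul hz0
  have h2 : (z • cplx E' - cplx A')ᴴ * (pencilResolvent A' E' z)ᴴ = 1 := by
    rw [← conjTranspose_mul, h'.resolvent_mul hz0, conjTranspose_one]
  rw [hW, Matrix.mul_add, Matrix.add_mul, conjTranspose_mul]
  congr 1
  · rw [← Matrix.mul_assoc, ← Matrix.mul_assoc, h1, Matrix.one_mul, Matrix.mul_assoc]
  · rw [Matrix.mul_assoc, Matrix.mul_assoc (cplx E * cplx X), h2, Matrix.mul_one,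
      ← Matrix.mul_assoc]

lemma IsRegularStable.continuous_resolvent_apply (h : IsRegularStable A E) (i j : Fin n) :
    Continuous fun ω : ℝ => pencilResolvent A E (Complex.I * ω) i j :=
  (continuous_apply_apply i j).comp h.continuous_resolvent

/-- Each of the two summands contributes `π X` in the limit. -/
lemma tendsto_integral_of_sylvester (h : IsRegularStable A E) (h' : IsRegularStable A' E')
    {X W : Matrix (Fin n) (Fin r) ℝ} (hX : A * X * E'ᵀ + E * X * A'ᵀ + W = 0)
    (i : Fin n) (j : Fin r) :
    Tendsto (fun T : ℝ => ∫ ω in -T..T, (pencilResolvent A E (Complex.I * ω) * cplx W *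
      (pencilResolvent A' E' (Complex.I * ω))ᴴ) i j) atTop (𝓝 ((2 * Real.pi * X i j : ℝ) : ℂ)) := by
  have c1 : ∀ k, Continuous fun ω : ℝ => (pencilResolvent A E (Complex.I * ω) * cplx E) i k :=
    fun k => (continuous_apply_apply i k).comp (h.continuous_resolvent.matrix_mul continuous_const)
  have c2 : ∀ k, Continuous fun ω : ℝ =>
      conj ((pencilResolvent A' E' (Complex.I * ω) * cplx E') j k) :=
    fun k => Complex.continuous_conj.comp
      ((continuous_apply_apply j k).comp (h'.continuous_resolvent.matrix_mul continuous_const))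
  have l1 : Tendsto (fun T : ℝ => ∑ k, ∫ ω in -T..T, cplx X i k *
      conj ((pencilResolvent A' E' (Complex.I * ω) * cplx E') j k)) atTop
      (𝓝 (∑ k, cplx X i k * conj ((Real.pi : ℂ) * (1 : Matrix (Fin r) (Fin r) ℂ) j k))) := by
    refine tendsto_finsetSum _ fun k _ => ?_
    simp only [intervalIntegral.integral_const_mul, intervalIntegral.intervalIntegral_conj]
    exact ((Complex.continuous_conj.tendsto _).comp
      (h'.tendsto_integral_resolvent_mul j k)).const_mul _
  have l2 : Tendsto (fun T : ℝ => ∑ k, ∫ ω in -T..T,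
      (pencilResolvent A E (Complex.I * ω) * cplx E) i k * cplx X k j) atTop
      (𝓝 (∑ k, (Real.pi : ℂ) * (1 : Matrix (Fin n) (Fin n) ℂ) i k * cplx X k j)) := by
    refine tendsto_finsetSum _ fun k _ => ?_
    simp only [intervalIntegral.integral_mul_const]
    exact (h.tendsto_integral_resolvent_mul i k).mul_const _
  have e : (∑ k, cplx X i k * conj ((Real.pi : ℂ) * (1 : Matrix (Fin r) (Fin r) ℂ) j k)) +
      (∑ k, (Real.pi : ℂ) * (1 : Matrix (Fin n) (Fin n) ℂ) i k * cplx X k j) =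
      ((2 * Real.pi * X i j : ℝ) : ℂ) := by
    simp only [Matrix.one_apply, mul_ite, mul_one, mul_zero, ite_mul, zero_mul, apply_ite conj,
      map_zero, Complex.conj_ofReal, Finset.sum_ite_eq, Finset.mem_univ, if_true, Matrix.map_apply]
    push_cast
    ring
  rw [← e]
  refine (l1.add l2).congr fun T => ?_
  rw [← intervalIntegral.integral_finsetSum, ← intervalIntegral.integral_finsetSum,
    ← intervalIntegral.integral_add]
  · refine intervalIntegral.integral_congr fun ω _ => ?_
    simp only [resolvent_mul_resolvent_of_sylvester h h' hX ω]
    simp only [Matrix.add_apply, Matrix.mul_apply (M := cplx X), conjTranspose_apply,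
      Matrix.mul_apply (N := cplx X)]
    rfl
  · exact (continuous_finsetSum _ fun k _ => continuous_const.mul (c2 k)).intervalIntegrable _ _
  · exact (continuous_finsetSum _ fun k _ => (c1 k).mul continuous_const).intervalIntegrable _ _
  · exact fun k _ => ((c1 k).mul continuous_const).intervalIntegrable _ _
  · exact fun k _ => (continuous_const.mul (c2 k)).intervalIntegrable _ _

/-- A product of two resolvent entries is dominated by a multiple of `1 / (1 + ω²)`, so symmetric
limits of such products are genuine integrals. -/
lemma integrable_resolvent_mul_conj (h : IsRegularStable A E) (h' : IsRegularStable A' E')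
    (i j : Fin n) (k l : Fin r) :
    Integrable fun ω : ℝ => pencilResolvent A E (Complex.I * ω) i j *
      conj (pencilResolvent A' E' (Complex.I * ω) k l) := by
  obtain ⟨c, hc0, hc⟩ := h.exists_resolvent_bound
  obtain ⟨c', hc0', hc'⟩ := h'.exists_resolvent_bound
  refine (integrable_inv_one_add_sq.const_mul (c * c')).mono'
    ((h.continuous_resolvent_apply i j).mul (Complex.continuous_conj.comp
      (h'.continuous_resolvent_apply k l))).aestronglyMeasurable (ae_of_all _ fun ω => ?_)
  have h1 := hc (Complex.I * ω) (by simp) i j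
  have h2 := hc' (Complex.I * ω) (by simp) k l
  rw [norm_mul, Complex.norm_I, one_mul, Complex.norm_real, Real.norm_eq_abs] at h1 h2
  rw [norm_mul, RCLike.norm_conj, ← div_eq_mul_inv, le_div_iff₀ (by positivity)]
  have h3 := mul_le_mul h1 h2 (by positivity) hc0
  refine le_trans ?_ h3
  have h4 : 1 + ω ^ 2 ≤ (1 + |ω|) * (1 + |ω|) := by
    have := abs_nonneg ω
    have := sq_abs ω
    nlinarith
  calc _ ≤ _ := mul_le_mul_of_nonneg_left h4 (by positivity)
    _ = _ := by ring

lemma integrable_resolvent_mul_resolvent (h : IsRegularStable A E) (h' : IsRegularStable A' E')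
    (W : Matrix (Fin n) (Fin r) ℝ) (i : Fin n) (j : Fin r) :
    Integrable fun ω : ℝ => (pencilResolvent A E (Complex.I * ω) * cplx W *
      (pencilResolvent A' E' (Complex.I * ω))ᴴ) i j := by
  simp only [Matrix.mul_apply, Finset.sum_mul]
  refine integrable_finsetSum _ fun k _ => integrable_finsetSum _ fun l _ => ?_
  refine ((integrable_resolvent_mul_conj h h' i l j k).mul_const (cplx W l k)).congr
    (ae_of_all _ fun ω => ?_)
  simp only [conjTranspose_apply, RCLike.star_def]
  ring

lemma integral_resolvent_mul_resolvent (h : IsRegularStable A E) (h' : IsRegularStable A' E')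
    {X W : Matrix (Fin n) (Fin r) ℝ} (hX : A * X * E'ᵀ + E * X * A'ᵀ + W = 0)
    (i : Fin n) (j : Fin r) :
    ∫ ω : ℝ, (pencilResolvent A E (Complex.I * ω) * cplx W *
      (pencilResolvent A' E' (Complex.I * ω))ᴴ) i j = ((2 * Real.pi * X i j : ℝ) : ℂ) :=
  tendsto_nhds_unique (intervalIntegral_tendsto_integral
    (integrable_resolvent_mul_resolvent h h' W i j) tendsto_neg_atTop_atBot tendsto_id)
    (tendsto_integral_of_sylvester h h' hX i j)

/-- The integral formula with `W = 0` represents `2π X` as the integral of zero. -/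
lemma eq_zero_of_sylvester_eq_zero (h : IsRegularStable A E) (h' : IsRegularStable A' E')
    {X : Matrix (Fin n) (Fin r) ℝ} (hX : A * X * E'ᵀ + E * X * A'ᵀ = 0) : X = 0 := by
  ext i j
  have := integral_resolvent_mul_resolvent h h' (W := 0) (by rw [hX, add_zero]) i j
  have h0 : cplx (0 : Matrix (Fin n) (Fin r) ℝ) = 0 := by ext; simp
  simp only [h0, Matrix.mul_zero, Matrix.zero_mul, Matrix.zero_apply, integral_zero] at this
  have h2 : 2 * Real.pi * X i j = 0 := by exact_mod_cast this.symm
  exact (mul_eq_zero.1 h2).resolve_left (by positivity)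

/-- The matrix of `X ↦ A X E'ᵀ + E X A'ᵀ` acting on vectorized matrices. -/
def sylvesterMatrix (A E : Matrix (Fin n) (Fin n) ℝ) (A' E' : Matrix (Fin r) (Fin r) ℝ) :
    Matrix (Fin r × Fin n) (Fin r × Fin n) ℝ :=
  kroneckerMap (· * ·) E' A + kroneckerMap (· * ·) A' E

/-- The solution `X` of `A X E'ᵀ + E X A'ᵀ + W = 0`, when the equation is uniquely solvable. -/
def sylvesterSol (A E : Matrix (Fin n) (Fin n) ℝ) (A' E' : Matrix (Fin r) (Fin r) ℝ)
    (W : Matrix (Fin n) (Fin r) ℝ) : Matrix (Fin n) (Fin r) ℝ :=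
  Matrix.of fun i j => -((sylvesterMatrix A E A' E')⁻¹ *ᵥ vec W) (j, i)

lemma sylvesterMatrix_mulVec (X : Matrix (Fin n) (Fin r) ℝ) :
    sylvesterMatrix A E A' E' *ᵥ vec X = vec (A * X * E'ᵀ + E * X * A'ᵀ) := by
  rw [sylvesterMatrix, add_mulVec, kronecker_mulVec_vec, kronecker_mulVec_vec, vec_add]

/-- In finite dimension, the injectivity just obtained makes the square Kronecker matrix invertible;
existence of solutions needs no further analysis. -/
lemma det_sylvesterMatrix_ne_zero (h : IsRegularStable A E) (h' : IsRegularStable A' E') :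
    (sylvesterMatrix A E A' E').det ≠ 0 := by
  intro h0
  obtain ⟨v, hv0, hv⟩ := Matrix.exists_mulVec_eq_zero_iff.2 h0
  obtain ⟨X, rfl⟩ := vec_bijective.2 v
  rw [sylvesterMatrix_mulVec, vec_eq_zero_iff] at hv
  exact hv0 (by rw [eq_zero_of_sylvester_eq_zero h h' hv, vec_zero])

lemma sylvesterSol_spec (h : IsRegularStable A E) (h' : IsRegularStable A' E')
    (W : Matrix (Fin n) (Fin r) ℝ) :
    A * sylvesterSol A E A' E' W * E'ᵀ + E * sylvesterSol A E A' E' W * A'ᵀ + W = 0 := by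
  rw [← vec_inj, vec_add, ← sylvesterMatrix_mulVec, vec_zero]
  have : vec (sylvesterSol A E A' E' W) = -((sylvesterMatrix A E A' E')⁻¹ *ᵥ vec W) := rfl
  rw [this, mulVec_neg, mulVec_mulVec,
    mul_nonsing_inv _ (isUnit_iff_ne_zero.2 (det_sylvesterMatrix_ne_zero h h')), one_mulVec,
    neg_add_cancel]

lemma eq_sylvesterSol (h : IsRegularStable A E) (h' : IsRegularStable A' E')
    {X W : Matrix (Fin n) (Fin r) ℝ} (hX : A * X * E'ᵀ + E * X * A'ᵀ + W = 0) :
    X = sylvesterSol A E A' E' W := by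
  refine sub_eq_zero.1 (eq_zero_of_sylvester_eq_zero h h' ?_)
  have := sylvesterSol_spec h h' W
  simp only [Matrix.mul_sub, Matrix.sub_mul]
  rw [← sub_self (0 : Matrix (Fin n) (Fin r) ℝ)]
  nth_rewrite 1 [← hX]
  rw [← this]
  abel

/-- The parameter space `Y` is left general: it is the box for the Gramians of fixed models, and the
product of the box with the admissible coefficient tuples for the slopes. -/
lemma continuousOn_sylvesterSol {Y : Type*} [TopologicalSpace Y]
    {fA fE : Y → Matrix (Fin n) (Fin n) ℝ} {fA' fE' : Y → Matrix (Fin r) (Fin r) ℝ}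
    {fW : Y → Matrix (Fin n) (Fin r) ℝ} {s : Set Y} (hA : ContinuousOn fA s)
    (hE : ContinuousOn fE s) (hA' : ContinuousOn fA' s) (hE' : ContinuousOn fE' s)
    (hW : ContinuousOn fW s) (h : ∀ y ∈ s, IsRegularStable (fA y) (fE y))
    (h' : ∀ y ∈ s, IsRegularStable (fA' y) (fE' y)) :
    ContinuousOn (fun y => sylvesterSol (fA y) (fE y) (fA' y) (fE' y) (fW y)) s := by
  have hp : ∀ {a b : ℕ} {f : Y → Matrix (Fin a) (Fin b) ℝ}, ContinuousOn f s → ∀ i j,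
      ContinuousOn (fun y => f y i j) s := fun hf i j =>
    (continuous_apply_apply i j).comp_continuousOn hf
  have hS : ContinuousOn (fun y => sylvesterMatrix (fA y) (fE y) (fA' y) (fE' y)) s := by
    refine continuousOn_pi.2 fun i => continuousOn_pi.2 fun j => ?_
    exact ((hp hE' _ _).mul (hp hA _ _)).add ((hp hA' _ _).mul (hp hE _ _))
  have hI : ContinuousOn (fun y => (sylvesterMatrix (fA y) (fE y) (fA' y) (fE' y))⁻¹) s :=
    fun y hy => ContinuousAt.comp_continuousWithinAt
      (f := fun y => sylvesterMatrix (fA y) (fE y) (fA' y) (fE' y))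
      (continuousAt_matrix_inv_of_det_ne_zero (det_sylvesterMatrix_ne_zero (h y hy) (h' y hy)))
      (hS y hy)
  refine continuousOn_pi.2 fun i => continuousOn_pi.2 fun j => ContinuousOn.neg ?_
  simp only [mulVec, dotProduct]
  exact continuousOn_finsetSum _ fun k _ =>
    ((continuous_apply_apply _ _).comp_continuousOn hI).mul (hp hW k.2 k.1)

end Sylvester

/-! ### The squared `H₂` distance through Gramians -/

section H2

variable {n r m p : ℕ} {A E : Matrix (Fin n) (Fin n) ℝ} {A' E' : Matrix (Fin r) (Fin r) ℝ}

/-- The transfer function of a single (non-parametric) system. -/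
def transferMatrix (A E : Matrix (Fin n) (Fin n) ℝ) (B : Matrix (Fin n) (Fin m) ℝ)
    (C : Matrix (Fin p) (Fin n) ℝ) (s : ℂ) : Matrix (Fin p) (Fin m) ℂ :=
  cplx C * pencilResolvent A E s * cplx B

/-- The left side is the trace of `G G'ᴴ`, in which `B` and `B'` meet as `B B'ᵀ`. This isolates the
resolvent product whose integral is a Sylvester solution. -/
lemma sum_transferMatrix_mul_conj (B : Matrix (Fin n) (Fin m) ℝ) (C : Matrix (Fin p) (Fin n) ℝ)
    (B' : Matrix (Fin r) (Fin m) ℝ) (C' : Matrix (Fin p) (Fin r) ℝ) (s : ℂ) :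
    ∑ i, ∑ j, transferMatrix A E B C s i j * conj (transferMatrix A' E' B' C' s i j) =
      ∑ i, ∑ l, ∑ k, cplx C i k * (pencilResolvent A E s * cplx (B * B'ᵀ) *
        (pencilResolvent A' E' s)ᴴ) k l * cplx C' i l := by
  have : ∀ i, ∑ j, transferMatrix A E B C s i j * conj (transferMatrix A' E' B' C' s i j) =
      (cplx C * (pencilResolvent A E s * cplx (B * B'ᵀ) * (pencilResolvent A' E' s)ᴴ) *
        (cplx C')ᴴ) i i := by
    intro i
    have e : cplx C * (pencilResolvent A E s * cplx (B * B'ᵀ) * (pencilResolvent A' E' s)ᴴ) *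
        (cplx C')ᴴ = transferMatrix A E B C s * (transferMatrix A' E' B' C' s)ᴴ := by
      simp only [transferMatrix, conjTranspose_mul, cplx_mul, ← conjTranspose_cplx,
        Matrix.mul_assoc]
    rw [e, Matrix.mul_apply]
    rfl
  refine Finset.sum_congr rfl fun i _ => ?_
  rw [this, Matrix.mul_apply]
  refine Finset.sum_congr rfl fun l _ => ?_
  rw [Matrix.mul_apply, Finset.sum_mul]
  refine Finset.sum_congr rfl fun k _ => ?_
  simp [conjTranspose_apply]

lemma integrable_sum_transferMatrix_mul_conj (h : IsRegularStable A E)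
    (h' : IsRegularStable A' E') (B : Matrix (Fin n) (Fin m) ℝ) (C : Matrix (Fin p) (Fin n) ℝ)
    (B' : Matrix (Fin r) (Fin m) ℝ) (C' : Matrix (Fin p) (Fin r) ℝ) :
    Integrable fun ω : ℝ => ∑ i, ∑ j, transferMatrix A E B C (Complex.I * ω) i j *
      conj (transferMatrix A' E' B' C' (Complex.I * ω) i j) := by
  simp only [sum_transferMatrix_mul_conj]
  exact integrable_finsetSum _ fun i _ => integrable_finsetSum _ fun l _ =>
    integrable_finsetSum _ fun k _ =>
      ((integrable_resolvent_mul_resolvent h h' _ k l).const_mul _).mul_const _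

lemma integral_sum_transferMatrix_mul_conj (h : IsRegularStable A E)
    (h' : IsRegularStable A' E') (B : Matrix (Fin n) (Fin m) ℝ) (C : Matrix (Fin p) (Fin n) ℝ)
    (B' : Matrix (Fin r) (Fin m) ℝ) (C' : Matrix (Fin p) (Fin r) ℝ) :
    ∫ ω : ℝ, ∑ i, ∑ j, transferMatrix A E B C (Complex.I * ω) i j *
      conj (transferMatrix A' E' B' C' (Complex.I * ω) i j) =
      ((2 * Real.pi * (C * sylvesterSol A E A' E' (B * B'ᵀ) * C'ᵀ).trace : ℝ) : ℂ) := by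
  have hi := integrable_resolvent_mul_resolvent h h' (B * B'ᵀ)
  simp only [sum_transferMatrix_mul_conj]
  rw [integral_finsetSum _ fun i _ => integrable_finsetSum _ fun l _ =>
    integrable_finsetSum _ fun k _ => ((hi k l).const_mul _).mul_const _]
  have : ∀ i, ∫ ω : ℝ, ∑ l, ∑ k, cplx C i k * (pencilResolvent A E (Complex.I * ω) *
      cplx (B * B'ᵀ) * (pencilResolvent A' E' (Complex.I * ω))ᴴ) k l * cplx C' i l =
      ∑ l, ∑ k, cplx C i k * ((2 * Real.pi * sylvesterSol A E A' E' (B * B'ᵀ) k l : ℝ) : ℂ) *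
        cplx C' i l := by
    intro i
    rw [integral_finsetSum _ fun l _ =>
      integrable_finsetSum _ fun k _ => ((hi k l).const_mul _).mul_const _]
    refine Finset.sum_congr rfl fun l _ => ?_
    rw [integral_finsetSum _ fun k _ => ((hi k l).const_mul _).mul_const _]
    refine Finset.sum_congr rfl fun k _ => ?_
    rw [integral_mul_const, integral_const_mul,
      integral_resolvent_mul_resolvent h h' (sylvesterSol_spec h h' _)]
  rw [Finset.sum_congr rfl fun i _ => this i]
  simp only [Matrix.trace, Matrix.diag_apply, Matrix.mul_apply (N := C'ᵀ),
    Matrix.mul_apply (M := C), transpose_apply, Matrix.map_apply]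
  push_cast
  simp only [Finset.mul_sum, Finset.sum_mul]
  refine Finset.sum_congr rfl fun i _ => Finset.sum_congr rfl fun l _ =>
    Finset.sum_congr rfl fun k _ => ?_
  ring

/-- The squared `H₂` distance of two systems, expressed through their controllability Gramians. -/
def gramianSqDist (A E : Matrix (Fin n) (Fin n) ℝ) (B : Matrix (Fin n) (Fin m) ℝ)
    (C : Matrix (Fin p) (Fin n) ℝ) (A' E' : Matrix (Fin r) (Fin r) ℝ)
    (B' : Matrix (Fin r) (Fin m) ℝ) (C' : Matrix (Fin p) (Fin r) ℝ) : ℝ :=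
  (C * sylvesterSol A E A E (B * Bᵀ) * Cᵀ).trace -
    2 * (C * sylvesterSol A E A' E' (B * B'ᵀ) * C'ᵀ).trace +
    (C' * sylvesterSol A' E' A' E' (B' * B'ᵀ) * C'ᵀ).trace

lemma norm_sub_sq_eq (a b : ℂ) :
    ‖a - b‖ ^ 2 = (a * conj a).re - 2 * (a * conj b).re + (b * conj b).re := by
  rw [← Complex.normSq_eq_norm_sq, Complex.normSq_apply]
  simp
  ring

lemma sum_norm_sub_sq_eq (G G' : Matrix (Fin p) (Fin m) ℂ) :
    ∑ i, ∑ j, ‖G i j - G' i j‖ ^ 2 = (∑ i, ∑ j, G i j * conj (G i j)).re -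
      2 * (∑ i, ∑ j, G i j * conj (G' i j)).re + (∑ i, ∑ j, G' i j * conj (G' i j)).re := by
  simp only [norm_sub_sq_eq, Finset.sum_add_distrib, Finset.sum_sub_distrib, ← Finset.mul_sum,
    Complex.re_sum]

lemma integrable_sum_norm_sub_sq (h : IsRegularStable A E)
    (h' : IsRegularStable A' E') (B : Matrix (Fin n) (Fin m) ℝ) (C : Matrix (Fin p) (Fin n) ℝ)
    (B' : Matrix (Fin r) (Fin m) ℝ) (C' : Matrix (Fin p) (Fin r) ℝ) :
    Integrable fun ω : ℝ => ∑ i, ∑ j, ‖transferMatrix A E B C (Complex.I * ω) i j -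
      transferMatrix A' E' B' C' (Complex.I * ω) i j‖ ^ 2 := by
  simp only [sum_norm_sub_sq_eq]
  exact ((integrable_sum_transferMatrix_mul_conj h h B C B C).re.sub
    ((integrable_sum_transferMatrix_mul_conj h h' B C B' C').re.const_mul 2)).add
    (integrable_sum_transferMatrix_mul_conj h' h' B' C' B' C').re

lemma integral_re_sub_two_mul_re_add_re {f g k : ℝ → ℂ} (hf : Integrable f) (hg : Integrable g)
    (hk : Integrable k) : ∫ ω, ((f ω).re - 2 * (g ω).re + (k ω).re) =
      (∫ ω, f ω).re - 2 * (∫ ω, g ω).re + (∫ ω, k ω).re := by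
  have hf' : Integrable fun ω => (f ω).re := hf.re
  have hg' : Integrable fun ω => (g ω).re := hg.re
  have hk' : Integrable fun ω => (k ω).re := hk.re
  have e1 : ∫ ω, (f ω).re = (∫ ω, f ω).re := integral_re hf
  have e2 : ∫ ω, (g ω).re = (∫ ω, g ω).re := integral_re hg
  have e3 : ∫ ω, (k ω).re = (∫ ω, k ω).re := integral_re hk
  have hs : Integrable fun ω => (f ω).re - 2 * (g ω).re := hf'.sub (hg'.const_mul 2)
  rw [integral_add hs hk', integral_sub hf' (hg'.const_mul 2),
    integral_const_mul, e1, e2, e3]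

lemma integral_sum_norm_sub_sq (h : IsRegularStable A E)
    (h' : IsRegularStable A' E') (B : Matrix (Fin n) (Fin m) ℝ) (C : Matrix (Fin p) (Fin n) ℝ)
    (B' : Matrix (Fin r) (Fin m) ℝ) (C' : Matrix (Fin p) (Fin r) ℝ) :
    ∫ ω : ℝ, ∑ i, ∑ j, ‖transferMatrix A E B C (Complex.I * ω) i j -
      transferMatrix A' E' B' C' (Complex.I * ω) i j‖ ^ 2 =
      2 * Real.pi * gramianSqDist A E B C A' E' B' C' := by
  simp only [sum_norm_sub_sq_eq]
  refine (integral_re_sub_two_mul_re_add_re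
    (integrable_sum_transferMatrix_mul_conj h h B C B C)
    (integrable_sum_transferMatrix_mul_conj h h' B C B' C')
    (integrable_sum_transferMatrix_mul_conj h' h' B' C' B' C')).trans ?_
  rw [integral_sum_transferMatrix_mul_conj h h, integral_sum_transferMatrix_mul_conj h h',
    integral_sum_transferMatrix_mul_conj h' h', gramianSqDist]
  simp only [Complex.ofReal_re]
  ring

/-- Positivity is read off from the frequency integral; it allows passage between real and extended
nonnegative values. -/
lemma gramianSqDist_nonneg (h : IsRegularStable A E)
    (h' : IsRegularStable A' E') (B : Matrix (Fin n) (Fin m) ℝ) (C : Matrix (Fin p) (Fin n) ℝ)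
    (B' : Matrix (Fin r) (Fin m) ℝ) (C' : Matrix (Fin p) (Fin r) ℝ) :
    0 ≤ gramianSqDist A E B C A' E' B' C' := by
  have h1 := integral_sum_norm_sub_sq h h' B C B' C'
  have h2 : (0 : ℝ) ≤ ∫ ω : ℝ, ∑ i, ∑ j, ‖transferMatrix A E B C (Complex.I * ω) i j -
      transferMatrix A' E' B' C' (Complex.I * ω) i j‖ ^ 2 :=
    integral_nonneg fun ω => Finset.sum_nonneg fun i _ => Finset.sum_nonneg fun j _ => sq_nonneg _
  rw [h1] at h2
  exact nonneg_of_mul_nonneg_right h2 (by positivity)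

lemma ENNReal.rpow_half_sq (a : ℝ≥0∞) : (a ^ (1 / 2 : ℝ)) ^ 2 = a := by
  rw [← ENNReal.rpow_natCast, ← ENNReal.rpow_mul]
  norm_num

lemma h2Norm_sub_sq (h : IsRegularStable A E)
    (h' : IsRegularStable A' E') (B : Matrix (Fin n) (Fin m) ℝ) (C : Matrix (Fin p) (Fin n) ℝ)
    (B' : Matrix (Fin r) (Fin m) ℝ) (C' : Matrix (Fin p) (Fin r) ℝ) :
    h2Norm (fun s => transferMatrix A E B C s - transferMatrix A' E' B' C' s) ^ 2 =
      ENNReal.ofReal (gramianSqDist A E B C A' E' B' C') := by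
  rw [h2Norm, ENNReal.rpow_half_sq]
  have e : ∀ ω : ℝ, ∑ i, ∑ j, ‖(transferMatrix A E B C (Complex.I * ω) -
      transferMatrix A' E' B' C' (Complex.I * ω)) i j‖ₑ ^ 2 =
      ENNReal.ofReal (∑ i, ∑ j, ‖transferMatrix A E B C (Complex.I * ω) i j -
        transferMatrix A' E' B' C' (Complex.I * ω) i j‖ ^ 2) := by
    intro ω
    rw [ENNReal.ofReal_sum_of_nonneg fun i _ => Finset.sum_nonneg fun j _ => sq_nonneg _]
    refine Finset.sum_congr rfl fun i _ => ?_
    rw [ENNReal.ofReal_sum_of_nonneg fun j _ => sq_nonneg _]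
    refine Finset.sum_congr rfl fun j _ => ?_
    rw [ENNReal.ofReal_pow (norm_nonneg _), ofReal_norm, Matrix.sub_apply]
  simp only [e]
  rw [← ofReal_integral_eq_lintegral_ofReal (integrable_sum_norm_sub_sq h h' B C B' C')
    (ae_of_all _ fun ω => Finset.sum_nonneg fun i _ => Finset.sum_nonneg fun j _ => sq_nonneg _),
    ← ENNReal.ofReal_mul (by positivity), integral_sum_norm_sub_sq h h']
  congr 1
  field_simp

end H2

/-! ### Integration over the parameter domain -/

section Systems

variable {d n r m p : ℕ} {K : Set (Fin d → ℝ)}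

/-- The coefficients of `S` are continuous on `K` and its pencil is regular and stable there. -/
structure ParamSystem.IsRegularStableOn (S : ParamSystem d n m p) (K : Set (Fin d → ℝ)) :
    Prop where
  regularStable : ∀ x ∈ K, IsRegularStable (S.A x) (S.E x)
  E : ContinuousOn S.E K
  A : ContinuousOn S.A K
  B : ContinuousOn S.B K
  C : ContinuousOn S.C K

/-- The squared `H₂` distance of two parametric systems at a parameter. -/
def sqDistAt (S : ParamSystem d n m p) (R : ParamSystem d r m p) (x : Fin d → ℝ) : ℝ :=
  gramianSqDist (S.A x) (S.E x) (S.B x) (S.C x) (R.A x) (R.E x) (R.B x) (R.C x)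

variable {S : ParamSystem d n m p} {R : ParamSystem d r m p}

lemma continuousOn_matrix_mul {Y : Type*} [TopologicalSpace Y] {s : Set Y} {a b c : ℕ}
    {f : Y → Matrix (Fin a) (Fin b) ℝ} {g : Y → Matrix (Fin b) (Fin c) ℝ}
    (hf : ContinuousOn f s) (hg : ContinuousOn g s) : ContinuousOn (fun y => f y * g y) s := by
  rw [continuousOn_iff_continuous_domRestrict] at *
  exact hf.matrix_mul hg

lemma continuousOn_matrix_transpose {Y : Type*} [TopologicalSpace Y] {s : Set Y} {a b : ℕ}
    {f : Y → Matrix (Fin a) (Fin b) ℝ} (hf : ContinuousOn f s) :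
    ContinuousOn (fun y => (f y)ᵀ) s := by
  rw [continuousOn_iff_continuous_domRestrict] at *
  exact hf.matrix_transpose

lemma continuousOn_matrix_trace {Y : Type*} [TopologicalSpace Y] {s : Set Y} {a : ℕ}
    {f : Y → Matrix (Fin a) (Fin a) ℝ} (hf : ContinuousOn f s) :
    ContinuousOn (fun y => (f y).trace) s := by
  rw [continuousOn_iff_continuous_domRestrict] at *
  exact hf.matrix_trace

lemma continuousOn_sqDistAt (hS : S.IsRegularStableOn K) (hR : R.IsRegularStableOn K) :
    ContinuousOn (sqDistAt S R) K := by
  have key : ∀ {n r : ℕ} {S : ParamSystem d n m p} {R : ParamSystem d r m p},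
      S.IsRegularStableOn K → R.IsRegularStableOn K → ContinuousOn (fun x => (S.C x *
        sylvesterSol (S.A x) (S.E x) (R.A x) (R.E x) (S.B x * (R.B x)ᵀ) * (R.C x)ᵀ).trace) K :=
    fun hS hR => continuousOn_matrix_trace (continuousOn_matrix_mul (continuousOn_matrix_mul hS.C
      (continuousOn_sylvesterSol hS.A hS.E hR.A hR.E (continuousOn_matrix_mul hS.B
        (continuousOn_matrix_transpose hR.B)) hS.regularStable hR.regularStable))
      (continuousOn_matrix_transpose hR.C))
  exact ((key hS hS).sub (continuousOn_const.mul (key hS hR))).add (key hR hR)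

lemma h2l2Error_sq (hK : IsCompact K) (hS : S.IsRegularStableOn K) (hR : R.IsRegularStableOn K) :
    h2l2Error K S R ^ 2 = ENNReal.ofReal (∫ x in K, sqDistAt S R x) := by
  rw [h2l2Error, h2l2Norm, ENNReal.rpow_half_sq, ofReal_integral_eq_lintegral_ofReal
    ((continuousOn_sqDistAt hS hR).integrableOn_compact hK)]
  · exact setLIntegral_congr_fun hK.measurableSet fun x hx =>
      h2Norm_sub_sq (hS.regularStable x hx) (hR.regularStable x hx) _ _ _ _
  · exact (ae_restrict_iff' hK.measurableSet).2 (ae_of_all _ fun x hx =>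
      gramianSqDist_nonneg (hS.regularStable x hx) (hR.regularStable x hx) _ _ _ _)

lemma h2l2Error_ne_top (hK : IsCompact K) (hS : S.IsRegularStableOn K)
    (hR : R.IsRegularStableOn K) : h2l2Error K S R ≠ ∞ := fun h => by
  have := h2l2Error_sq hK hS hR
  rw [h] at this
  exact ENNReal.ofReal_ne_top (this.symm.trans (by simp))

lemma toReal_h2l2Error_sq (hK : IsCompact K) (hS : S.IsRegularStableOn K)
    (hR : R.IsRegularStableOn K) :
    (h2l2Error K S R ^ 2).toReal = ∫ x in K, sqDistAt S R x := by
  rw [h2l2Error_sq hK hS hR, ENNReal.toReal_ofReal]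
  exact setIntegral_nonneg hK.measurableSet fun x hx =>
    gramianSqDist_nonneg (hS.regularStable x hx) (hR.regularStable x hx) _ _ _ _

end Systems

/-! ### Exact increments of Gramian traces -/

section Duality

variable {n r m p : ℕ}

lemma trace_mul_transpose_eq {a b : ℕ} (M N : Matrix (Fin a) (Fin b) ℝ) :
    (M * Nᵀ).trace = (Mᵀ * N).trace := by
  rw [← trace_transpose, transpose_mul, transpose_transpose, trace_mul_comm]

lemma trace_transpose_mul_eq_sum {a b : ℕ} (M N : Matrix (Fin a) (Fin b) ℝ) :
    (Mᵀ * N).trace = ∑ i, ∑ j, M i j * N i j := by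
  simp only [Matrix.trace, Matrix.diag_apply, Matrix.mul_apply, transpose_apply]
  exact Finset.sum_comm

/-- Pairing a dual Sylvester solution with the Sylvester operator. -/
lemma trace_eq_of_dual_sylvester {A E : Matrix (Fin n) (Fin n) ℝ} {A' E' : Matrix (Fin r) (Fin r) ℝ}
    {C : Matrix (Fin p) (Fin n) ℝ} {C' : Matrix (Fin p) (Fin r) ℝ} {Q : Matrix (Fin n) (Fin r) ℝ}
    (hQ : Aᵀ * Q * E' + Eᵀ * Q * A' = Cᵀ * C') (X : Matrix (Fin n) (Fin r) ℝ) :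
    (C * X * C'ᵀ).trace = (Qᵀ * A * X * E'ᵀ).trace + (Qᵀ * E * X * A'ᵀ).trace := by
  have h := congrArg transpose hQ
  simp only [transpose_add, transpose_mul, transpose_transpose] at h
  rw [trace_mul_comm, ← Matrix.mul_assoc, ← h, Matrix.add_mul, trace_add,
    trace_mul_comm _ E'ᵀ, trace_mul_comm _ A'ᵀ]
  simp only [Matrix.mul_assoc]

/-- `Q` solves the dual equation at model 1. Testing that equation with `P₁` and `P₂`, and pairing
the equations for `P₁` and `P₂` with `Q`, leaves only differences of coefficients. Since `P₂` is
kept at model 2, there is no second-order remainder. -/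
lemma trace_mixed_sub {A E : Matrix (Fin n) (Fin n) ℝ} {B : Matrix (Fin n) (Fin m) ℝ}
    {C : Matrix (Fin p) (Fin n) ℝ} {A₁ E₁ A₂ E₂ : Matrix (Fin r) (Fin r) ℝ}
    {B₁ B₂ : Matrix (Fin r) (Fin m) ℝ} {C₁ C₂ : Matrix (Fin p) (Fin r) ℝ}
    {P₁ P₂ Q : Matrix (Fin n) (Fin r) ℝ} (hQ : Aᵀ * Q * E₁ + Eᵀ * Q * A₁ = Cᵀ * C₁)
    (h₁ : A * P₁ * E₁ᵀ + E * P₁ * A₁ᵀ + B * B₁ᵀ = 0)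
    (h₂ : A * P₂ * E₂ᵀ + E * P₂ * A₂ᵀ + B * B₂ᵀ = 0) :
    (C * P₂ * C₂ᵀ).trace - (C * P₁ * C₁ᵀ).trace =
      ((C * P₂)ᵀ * (C₂ - C₁)).trace - ((Qᵀ * B)ᵀ * (B₂ - B₁)).trace -
        ((Qᵀ * A * P₂)ᵀ * (E₂ - E₁)).trace - ((Qᵀ * E * P₂)ᵀ * (A₂ - A₁)).trace := by
  have d₁ := trace_eq_of_dual_sylvester hQ P₁
  have d₂ := trace_eq_of_dual_sylvester hQ P₂
  have t₁ := congrArg (fun M => (Qᵀ * M).trace) h₁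
  have t₂ := congrArg (fun M => (Qᵀ * M).trace) h₂
  simp only [Matrix.mul_add, trace_add, ← Matrix.mul_assoc, Matrix.mul_zero, trace_zero] at t₁ t₂
  simp only [← trace_mul_transpose_eq, Matrix.mul_sub, trace_sub]
  linarith

lemma trace_mul_mul_transpose_eq {a b c e : ℕ} (Q : Matrix (Fin a) (Fin b) ℝ)
    (D : Matrix (Fin a) (Fin c) ℝ) (P : Matrix (Fin c) (Fin e) ℝ) (F : Matrix (Fin b) (Fin e) ℝ) :
    (Qᵀ * D * P * Fᵀ).trace = (Q * F * Pᵀ * Dᵀ).trace := by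
  rw [← trace_transpose]
  simp only [transpose_mul, transpose_transpose, Matrix.mul_assoc]
  rw [trace_mul_comm Q]
  simp only [Matrix.mul_assoc]

/-- Here the coefficients vary on both sides of `P`. Telescoping one side at a time gives two slope
terms per coefficient, with the unchanged factor taken once at model 1 and once at model 2. -/
lemma trace_reduced_sub {A₁ E₁ A₂ E₂ : Matrix (Fin r) (Fin r) ℝ}
    {B₁ B₂ : Matrix (Fin r) (Fin m) ℝ} {C₁ C₂ : Matrix (Fin p) (Fin r) ℝ}
    {P₁ P₂ Q : Matrix (Fin r) (Fin r) ℝ} (hQ : A₁ᵀ * Q * E₁ + E₁ᵀ * Q * A₁ + C₁ᵀ * C₁ = 0)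
    (h₁ : A₁ * P₁ * E₁ᵀ + E₁ * P₁ * A₁ᵀ + B₁ * B₁ᵀ = 0)
    (h₂ : A₂ * P₂ * E₂ᵀ + E₂ * P₂ * A₂ᵀ + B₂ * B₂ᵀ = 0) :
    (C₂ * P₂ * C₂ᵀ).trace - (C₁ * P₁ * C₁ᵀ).trace =
      ((C₂ * P₂ + C₁ * P₂ᵀ)ᵀ * (C₂ - C₁)).trace + ((Q * B₂ + Qᵀ * B₁)ᵀ * (B₂ - B₁)).trace +
        ((Qᵀ * A₁ * P₂ + Q * A₂ * P₂ᵀ)ᵀ * (E₂ - E₁)).trace +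
        ((Qᵀ * E₁ * P₂ + Q * E₂ * P₂ᵀ)ᵀ * (A₂ - A₁)).trace := by
  -- The sign of the reduced equation is absorbed into one copy of `C₁`, so the duality identity for
  -- the mixed case applies.
  have hQ' : A₁ᵀ * Q * E₁ + E₁ᵀ * Q * A₁ = (-C₁)ᵀ * C₁ := by
    rw [transpose_neg, Matrix.neg_mul]
    exact eq_neg_of_add_eq_zero_left hQ
  have d₁ := trace_eq_of_dual_sylvester hQ' P₁
  have d₂ := trace_eq_of_dual_sylvester hQ' P₂
  have t₁ := congrArg (fun M => (Qᵀ * M).trace) h₁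
  have t₂ := congrArg (fun M => (Qᵀ * M).trace) h₂
  simp only [Matrix.mul_add, trace_add, ← Matrix.mul_assoc, Matrix.mul_zero, trace_zero,
    Matrix.neg_mul, trace_neg] at t₁ t₂ d₁ d₂
  have hC : ∀ M : Matrix (Fin p) (Fin r) ℝ, (C₁ * P₂ᵀ * Mᵀ).trace = (M * P₂ * C₁ᵀ).trace := by
    intro M
    rw [← trace_transpose]
    simp only [transpose_mul, transpose_transpose, Matrix.mul_assoc]
  have hB : ∀ M : Matrix (Fin r) (Fin m) ℝ, (Q * B₂ * Mᵀ).trace = (Qᵀ * M * B₂ᵀ).trace := by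
    intro M
    have := trace_mul_mul_transpose_eq Q M (1 : Matrix (Fin m) (Fin m) ℝ) B₂
    simpa using this.symm
  simp only [← trace_mul_transpose_eq, Matrix.mul_sub, Matrix.add_mul, trace_sub,
    trace_add, hC, hB, ← trace_mul_mul_transpose_eq Q]
  linarith

end Duality

/-! ### Gramians of parametric systems -/

section Systems

variable {d n r m p : ℕ} {K : Set (Fin d → ℝ)}

/-- The mixed controllability Gramian of two parametric systems. -/
def ctrlGramian (S : ParamSystem d n m p) (R : ParamSystem d r m p) (x : Fin d → ℝ) :
    Matrix (Fin n) (Fin r) ℝ :=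
  sylvesterSol (S.A x) (S.E x) (R.A x) (R.E x) (S.B x * (R.B x)ᵀ)

/-- The mixed observability Gramian of two parametric systems. -/
def obsGramian (S : ParamSystem d n m p) (R : ParamSystem d r m p) (x : Fin d → ℝ) :
    Matrix (Fin n) (Fin r) ℝ :=
  sylvesterSol (S.A x)ᵀ (S.E x)ᵀ (R.A x)ᵀ (R.E x)ᵀ ((S.C x)ᵀ * R.C x)

variable {S : ParamSystem d n m p} {R : ParamSystem d r m p}

lemma continuousOn_ctrlGramian (hS : S.IsRegularStableOn K) (hR : R.IsRegularStableOn K) :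
    ContinuousOn (ctrlGramian S R) K :=
  continuousOn_sylvesterSol hS.A hS.E hR.A hR.E (continuousOn_matrix_mul hS.B
    (continuousOn_matrix_transpose hR.B)) hS.regularStable hR.regularStable

lemma continuousOn_obsGramian (hS : S.IsRegularStableOn K) (hR : R.IsRegularStableOn K) :
    ContinuousOn (obsGramian S R) K :=
  continuousOn_sylvesterSol (continuousOn_matrix_transpose hS.A) (continuousOn_matrix_transpose hS.E)
    (continuousOn_matrix_transpose hR.A) (continuousOn_matrix_transpose hR.E)
    (continuousOn_matrix_mul (continuousOn_matrix_transpose hS.C) hR.C)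
    (fun x hx => (hS.regularStable x hx).transpose) (fun x hx => (hR.regularStable x hx).transpose)

variable {x : Fin d → ℝ}

lemma solvesCtrlMixed_iff (hS : IsRegularStable (S.A x) (S.E x))
    (hR : IsRegularStable (R.A x) (R.E x)) {X : Matrix (Fin n) (Fin r) ℝ} :
    SolvesCtrlMixed S R x X ↔ X = ctrlGramian S R x :=
  ⟨fun h => eq_sylvesterSol hS hR h.symm, fun h => h ▸ (sylvesterSol_spec hS hR _).symm⟩

lemma solvesCtrlReduced_iff (hR : IsRegularStable (R.A x) (R.E x))
    {X : Matrix (Fin r) (Fin r) ℝ} : SolvesCtrlReduced R x X ↔ X = ctrlGramian R R x :=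
  solvesCtrlMixed_iff hR hR

lemma obsGramian_spec (hS : IsRegularStable (S.A x) (S.E x))
    (hR : IsRegularStable (R.A x) (R.E x)) :
    (S.A x)ᵀ * obsGramian S R x * R.E x + (S.E x)ᵀ * obsGramian S R x * R.A x +
      (S.C x)ᵀ * R.C x = 0 := by
  simpa [obsGramian] using sylvesterSol_spec hS.transpose hR.transpose ((S.C x)ᵀ * R.C x)

lemma eq_obsGramian (hS : IsRegularStable (S.A x) (S.E x))
    (hR : IsRegularStable (R.A x) (R.E x)) {X : Matrix (Fin n) (Fin r) ℝ}
    (hX : (S.A x)ᵀ * X * R.E x + (S.E x)ᵀ * X * R.A x + (S.C x)ᵀ * R.C x = 0) :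
    X = obsGramian S R x :=
  eq_sylvesterSol hS.transpose hR.transpose (by simpa using hX)

/-- The minus sign comes from the term `-Cᵀ Ĉ`, opposite to the convention of `obsGramian`. -/
lemma solvesObsMixed_iff (hS : IsRegularStable (S.A x) (S.E x))
    (hR : IsRegularStable (R.A x) (R.E x)) {X : Matrix (Fin n) (Fin r) ℝ} :
    SolvesObsMixed S R x X ↔ X = -obsGramian S R x := by
  have e : ∀ Y : Matrix (Fin n) (Fin r) ℝ, (S.A x)ᵀ * -Y * R.E x + (S.E x)ᵀ * -Y * R.A x -
      (S.C x)ᵀ * R.C x =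
      -((S.A x)ᵀ * Y * R.E x + (S.E x)ᵀ * Y * R.A x + (S.C x)ᵀ * R.C x) := by
    intro Y
    simp only [Matrix.mul_neg, Matrix.neg_mul]
    abel
  constructor
  · intro h
    rw [← eq_obsGramian hS hR (X := -X), neg_neg]
    have := e (-X)
    unfold SolvesObsMixed at h
    rw [neg_neg, ← h] at this
    exact neg_eq_zero.1 this.symm
  · rintro rfl
    rw [SolvesObsMixed, e, obsGramian_spec hS hR, neg_zero]

lemma solvesObsReduced_iff (hR : IsRegularStable (R.A x) (R.E x))
    {X : Matrix (Fin r) (Fin r) ℝ} : SolvesObsReduced R x X ↔ X = obsGramian R R x :=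
  ⟨fun h => eq_obsGramian hR hR h.symm, fun h => h ▸ (obsGramian_spec hR hR).symm⟩

/-- The transpose solves the same equation, so uniqueness gives symmetry. -/
lemma transpose_ctrlGramian_self (hR : IsRegularStable (R.A x) (R.E x)) :
    (ctrlGramian R R x)ᵀ = ctrlGramian R R x := by
  refine (solvesCtrlReduced_iff hR).1 ?_
  have h := congrArg transpose ((solvesCtrlReduced_iff hR).2 rfl)
  simp only [transpose_add, transpose_mul, transpose_transpose, transpose_zero] at h
  rw [SolvesCtrlReduced, h]
  simp only [Matrix.mul_assoc]
  abel

lemma transpose_obsGramian_self (hR : IsRegularStable (R.A x) (R.E x)) :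
    (obsGramian R R x)ᵀ = obsGramian R R x := by
  refine eq_obsGramian hR hR ?_
  have h := congrArg transpose (obsGramian_spec hR hR)
  simp only [transpose_add, transpose_mul, transpose_transpose, transpose_zero] at h
  rw [← h]
  simp only [Matrix.mul_assoc]
  abel

end Systems

/-! ### Carathéodory differentiability and integrals with parameters -/

section Calculus

/-- Carathéodory's criterion: the remainder is `(Φ v - Φ v₀) (v - v₀)`, so continuity of the slope
at the single point `v₀` suffices. -/
lemma hasFDerivAt_of_sub_eq {V : Type*} [NormedAddCommGroup V] [NormedSpace ℝ V] {f : V → ℝ}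
    {Φ : V → V →L[ℝ] ℝ} {v₀ : V} (hΦ : ContinuousAt Φ v₀)
    (hf : ∀ᶠ v in 𝓝 v₀, f v - f v₀ = Φ v (v - v₀)) : HasFDerivAt f (Φ v₀) v₀ := by
  rw [hasFDerivAt_iff_isLittleO]
  refine Asymptotics.isLittleO_iff.2 fun c hc => ?_
  have h1 : ∀ᶠ v in 𝓝 v₀, ‖Φ v - Φ v₀‖ < c := by
    have := Metric.continuousAt_iff'.1 hΦ c hc
    simpa only [dist_eq_norm] using this
  filter_upwards [hf, h1] with v hv hv1
  rw [hv, ← _root_.sub_apply]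
  exact (ContinuousLinearMap.le_opNorm _ _).trans
    (mul_le_mul_of_nonneg_right hv1.le (norm_nonneg _))

lemma hasFDerivAt_of_sub_eq_bilin {V : Type*} [NormedAddCommGroup V] [NormedSpace ℝ V]
    [FiniteDimensional ℝ V] {f : V → ℝ} (β : V →ₗ[ℝ] V →ₗ[ℝ] ℝ) {G : V → V} {v₀ : V}
    (hG : ContinuousAt G v₀) (hf : ∀ᶠ v in 𝓝 v₀, f v - f v₀ = β (G v) (v - v₀)) :
    HasFDerivAt f (LinearMap.toContinuousLinearMap (β (G v₀))) v₀ := by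
  have hβ : Continuous fun w => LinearMap.toContinuousLinearMap (β w) :=
    LinearMap.continuous_of_finiteDimensional
      ((LinearMap.toContinuousLinearMap (𝕜 := ℝ) (E := V) (F' := ℝ)).toLinearMap ∘ₗ β)
  exact hasFDerivAt_of_sub_eq (Φ := fun v => LinearMap.toContinuousLinearMap (β (G v)))
    (hβ.continuousAt.comp hG) hf

lemma hasFDerivAt_comp_affine {V W : Type*} [NormedAddCommGroup V] [NormedSpace ℝ V]
    [NormedAddCommGroup W] [NormedSpace ℝ W] {f : V → ℝ} {D : V →L[ℝ] ℝ} {v₀ : V}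
    (hf : HasFDerivAt f D v₀) (L : W →L[ℝ] V) (w₀ : W) :
    HasFDerivAt (fun w => f (v₀ + L (w - w₀))) (D ∘L L) w₀ := by
  have h0 : HasFDerivAt (fun w => w - w₀) (ContinuousLinearMap.id ℝ W) w₀ :=
    (hasFDerivAt_id w₀).sub_const w₀
  have h1 : HasFDerivAt (fun w => v₀ + L (w - w₀)) L w₀ :=
    (L.hasFDerivAt.comp w₀ h0).const_add v₀
  exact HasFDerivAt.comp w₀ (by simpa using hf) h1

/-- On `K` times a compact neighbourhood of `θ₀` the integrand is bounded, and a constant is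
integrable on `K`; dominated convergence applies. -/
lemma continuousAt_integral_of_continuousOn_prod {d : ℕ} {Θ : Type*} [TopologicalSpace Θ]
    [LocallyCompactSpace Θ] [FirstCountableTopology Θ] {K : Set (Fin d → ℝ)} (hK : IsCompact K)
    {U : Set Θ} (hU : IsOpen U) {F : (Fin d → ℝ) × Θ → ℝ} (hF : ContinuousOn F (K ×ˢ U)) {θ₀ : Θ}
    (hθ : θ₀ ∈ U) : ContinuousAt (fun θ => ∫ x in K, F (x, θ)) θ₀ := by
  obtain ⟨N, hN, hθN, hNU⟩ := exists_compact_subset hU hθ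
  obtain ⟨c, hc⟩ := (hK.prod hN).exists_bound_of_continuousOn (hF.mono (Set.prod_mono_right hNU))
  refine continuousAt_of_dominated (bound := fun _ => c) ?_ ?_ ?_ ?_
  · filter_upwards [hU.mem_nhds hθ] with θ h
    exact (hF.comp (f := fun x => (x, θ)) (by fun_prop)
      fun x hx => ⟨hx, h⟩).aestronglyMeasurable hK.measurableSet
  · filter_upwards [mem_interior_iff_mem_nhds.1 hθN] with θ h
    exact (ae_restrict_iff' hK.measurableSet).2 (ae_of_all _ fun x hx => hc (x, θ) ⟨hx, h⟩)
  · exact integrableOn_const hK.measure_lt_top.ne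
  · refine (ae_restrict_iff' hK.measurableSet).2 (ae_of_all _ fun x hx => ?_)
    exact (hF.comp (f := fun θ => (x, θ)) (by fun_prop)
      fun θ h => ⟨hx, h⟩ : ContinuousOn (fun θ => F (x, θ)) U).continuousAt (hU.mem_nhds hθ)

lemma continuousOn_entry {Y : Type*} [TopologicalSpace Y] {s : Set Y} {a b : ℕ}
    {f : Y → Matrix (Fin a) (Fin b) ℝ} (hf : ContinuousOn f s) (i : Fin a) (j : Fin b) :
    ContinuousOn (fun y => f y i j) s :=
  (continuous_apply_apply i j).comp_continuousOn hf

lemma continuousAt_matrixIntegral {d a b : ℕ} {Θ : Type*} [TopologicalSpace Θ]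
    [LocallyCompactSpace Θ] [FirstCountableTopology Θ] {K : Set (Fin d → ℝ)} (hK : IsCompact K)
    {U : Set Θ} (hU : IsOpen U) {F : (Fin d → ℝ) × Θ → Matrix (Fin a) (Fin b) ℝ}
    (hF : ContinuousOn F (K ×ˢ U)) {θ₀ : Θ} (hθ : θ₀ ∈ U) :
    ContinuousAt (fun θ => matrixIntegral K fun x => F (x, θ)) θ₀ :=
  continuousAt_pi.2 fun i => continuousAt_pi.2 fun j =>
    continuousAt_integral_of_continuousOn_prod hK hU (continuousOn_entry hF i j) hθ

variable {d a b : ℕ} {K : Set (Fin d → ℝ)} {M : (Fin d → ℝ) → Matrix (Fin a) (Fin b) ℝ}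

lemma integrableOn_trace_transpose_mul (hK : IsCompact K) (hM : ContinuousOn M K)
    (N : Matrix (Fin a) (Fin b) ℝ) : IntegrableOn (fun x => ((M x)ᵀ * N).trace) K :=
  (continuousOn_matrix_trace (continuousOn_matrix_mul (continuousOn_matrix_transpose hM)
    continuousOn_const)).integrableOn_compact hK

lemma integral_trace_transpose_mul (hK : IsCompact K) (hM : ContinuousOn M K)
    (N : Matrix (Fin a) (Fin b) ℝ) :
    ∫ x in K, ((M x)ᵀ * N).trace = ((matrixIntegral K M)ᵀ * N).trace := by
  have hi : ∀ i j, IntegrableOn (fun x => M x i j * N i j) K := fun i j =>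
    ((continuousOn_entry hM i j).integrableOn_compact hK).mul_const _
  simp only [trace_transpose_mul_eq_sum]
  rw [integral_finsetSum _ fun i _ => integrable_finsetSum _ fun j _ => hi i j]
  refine Finset.sum_congr rfl fun i _ => ?_
  rw [integral_finsetSum _ fun j _ => hi i j]
  exact Finset.sum_congr rfl fun j _ => integral_mul_const _ _

end Calculus

/-! ### Slopes of the squared error and openness of the admissible set -/

section Gradient

variable {d n r m p qE qA qB qC : ℕ} {K : Set (Fin d → ℝ)} (S : ParamSystem d n m p)
  (R R' : ParamSystem d r m p) (Qt : (Fin d → ℝ) → Matrix (Fin n) (Fin r) ℝ)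
  (Qh : (Fin d → ℝ) → Matrix (Fin r) (Fin r) ℝ) (x : Fin d → ℝ)

/-- The coefficient of `R'.E x - R.E x` in the increment of the squared distance to `S`. -/
def slopeE : Matrix (Fin r) (Fin r) ℝ :=
  (Qh x)ᵀ * R.A x * ctrlGramian R' R' x + Qh x * R'.A x * (ctrlGramian R' R' x)ᵀ +
    ((Qt x)ᵀ * S.A x * ctrlGramian S R' x + (Qt x)ᵀ * S.A x * ctrlGramian S R' x)

/-- The coefficient of `R'.A x - R.A x` in the increment of the squared distance to `S`. -/
def slopeA : Matrix (Fin r) (Fin r) ℝ :=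
  (Qh x)ᵀ * R.E x * ctrlGramian R' R' x + Qh x * R'.E x * (ctrlGramian R' R' x)ᵀ +
    ((Qt x)ᵀ * S.E x * ctrlGramian S R' x + (Qt x)ᵀ * S.E x * ctrlGramian S R' x)

/-- The coefficient of `R'.B x - R.B x` in the increment of the squared distance to `S`. -/
def slopeB : Matrix (Fin r) (Fin m) ℝ :=
  Qh x * R'.B x + (Qh x)ᵀ * R.B x + ((Qt x)ᵀ * S.B x + (Qt x)ᵀ * S.B x)

/-- The coefficient of `R'.C x - R.C x` in the increment of the squared distance to `S`. -/
def slopeC : Matrix (Fin p) (Fin r) ℝ :=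
  R'.C x * ctrlGramian R' R' x + R.C x * (ctrlGramian R' R' x)ᵀ -
    (S.C x * ctrlGramian S R' x + S.C x * ctrlGramian S R' x)

variable {S R R' Qt Qh x}

/-- The term depending on the full model alone cancels; the mixed increment enters with weight `-2`,
the reduced one with weight `1`. -/
lemma sqDistAt_sub (hS : IsRegularStable (S.A x) (S.E x)) (hR : IsRegularStable (R.A x) (R.E x))
    (hR' : IsRegularStable (R'.A x) (R'.E x)) (hQt : SolvesObsMixed S R x (Qt x))
    (hQh : SolvesObsReduced R x (Qh x)) :
    sqDistAt S R' x - sqDistAt S R x =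
      ((slopeE S R R' Qt Qh x)ᵀ * (R'.E x - R.E x)).trace +
      ((slopeA S R R' Qt Qh x)ᵀ * (R'.A x - R.A x)).trace +
      ((slopeB S R R' Qt Qh x)ᵀ * (R'.B x - R.B x)).trace +
      ((slopeC S R R' x)ᵀ * (R'.C x - R.C x)).trace := by
  have h1 := trace_mixed_sub (C₂ := R'.C x) (sub_eq_zero.1 hQt.symm)
    (sylvesterSol_spec hS hR (S.B x * (R.B x)ᵀ)) (sylvesterSol_spec hS hR' (S.B x * (R'.B x)ᵀ))
  have h2 := trace_reduced_sub (C₂ := R'.C x) hQh.symm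
    (sylvesterSol_spec hR hR (R.B x * (R.B x)ᵀ)) (sylvesterSol_spec hR' hR' (R'.B x * (R'.B x)ᵀ))
  simp only [sqDistAt, gramianSqDist, slopeE, slopeA, slopeB, slopeC, ctrlGramian, transpose_add,
    transpose_sub, Matrix.add_mul, Matrix.sub_mul, trace_add, trace_sub] at h1 h2 ⊢
  linarith

lemma slopeE_self (hR : IsRegularStable (R.A x) (R.E x)) (hQ : (Qh x)ᵀ = Qh x) :
    slopeE S R R Qt Qh x = (2 : ℝ) • ((Qh x)ᵀ * R.A x * ctrlGramian R R x +
      (Qt x)ᵀ * S.A x * ctrlGramian S R x) := by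
  rw [slopeE, transpose_ctrlGramian_self hR, hQ, two_smul]
  abel

lemma slopeA_self (hR : IsRegularStable (R.A x) (R.E x)) (hQ : (Qh x)ᵀ = Qh x) :
    slopeA S R R Qt Qh x = (2 : ℝ) • ((Qh x)ᵀ * R.E x * ctrlGramian R R x +
      (Qt x)ᵀ * S.E x * ctrlGramian S R x) := by
  rw [slopeA, transpose_ctrlGramian_self hR, hQ, two_smul]
  abel

lemma slopeB_self (hQ : (Qh x)ᵀ = Qh x) :
    slopeB S R R Qt Qh x = (2 : ℝ) • ((Qh x)ᵀ * R.B x + (Qt x)ᵀ * S.B x) := by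
  rw [slopeB, hQ, two_smul]
  abel

lemma slopeC_self (hR : IsRegularStable (R.A x) (R.E x)) :
    slopeC S R R x = (2 : ℝ) • (R.C x * ctrlGramian R R x - S.C x * ctrlGramian S R x) := by
  rw [slopeC, transpose_ctrlGramian_self hR, two_smul]
  abel

variable (φ : ScalarFunctions d qE qA qB qC)

lemma continuousOn_sum_smul {a b q : ℕ} {Θ : Type*} [TopologicalSpace Θ]
    {f : Fin q → (Fin d → ℝ) → ℝ} (hf : ∀ i, ContinuousOn (f i) K)
    {N : Θ → Fin q → Matrix (Fin a) (Fin b) ℝ} (hN : Continuous N) :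
    ContinuousOn (fun z : (Fin d → ℝ) × Θ => ∑ i, f i z.1 • N z.2 i) (K ×ˢ Set.univ) :=
  continuousOn_finsetSum _ fun i _ =>
    ((hf i).comp continuousOn_fst fun _ hz => hz.1).smul
      ((continuous_apply i).comp (hN.comp continuous_snd)).continuousOn

variable {φ}

/-- Stability is an open condition on the pair of matrices, which depends jointly continuously on
parameter and coefficients; compactness of `K` makes the neighbourhood uniform in the parameter. -/
lemma isOpen_admissibleROMs (hK : IsCompact K) (hφ : φ.ContinuousOn K) :
    IsOpen (admissibleROMs r m p K φ) := by
  have : CompactSpace K := isCompact_iff_compactSpace.1 hK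
  have hι : ∀ z : ROMCoeffs r m p qE qA qB qC × K, (((z.2 : Fin d → ℝ), z.1) :
      (Fin d → ℝ) × ROMCoeffs r m p qE qA qB qC) ∈ K ×ˢ Set.univ := fun z => ⟨z.2.2, trivial⟩
  have hA := (continuousOn_sum_smul hφ.a
    (continuous_fst.comp continuous_snd : Continuous fun θ : ROMCoeffs r m p qE qA qB qC =>
      θ.2.1)).comp_continuous (f := fun z : ROMCoeffs r m p qE qA qB qC × K => (z.2.1, z.1))
    (by fun_prop) hι
  have hE := (continuousOn_sum_smul hφ.e
    (continuous_fst : Continuous fun θ : ROMCoeffs r m p qE qA qB qC =>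
      θ.1)).comp_continuous (f := fun z : ROMCoeffs r m p qE qA qB qC × K => (z.2.1, z.1))
    (by fun_prop) hι
  rw [isOpen_iff_mem_nhds]
  intro θ hθ
  have key := isCompact_univ.eventually_forall_of_forall_eventually (x₀ := θ)
    (P := fun θ (x : K) => IsRegularStable ((romSystem φ θ).A x) ((romSystem φ θ).E x))
    fun x _ => by
      have h : ContinuousAt (fun z : ROMCoeffs r m p qE qA qB qC × K =>
        ((romSystem φ z.1).A z.2, (romSystem φ z.1).E z.2)) (θ, x) := (hA.prodMk hE).continuousAt
      exact h.eventually (isOpen_isRegularStable.mem_nhds (hθ x x.2))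
  filter_upwards [key] with θ' h x hx
  exact h ⟨x, hx⟩ trivial

lemma isRegularStableOn_romSystem (hφ : φ.ContinuousOn K) {θ : ROMCoeffs r m p qE qA qB qC}
    (hθ : θ ∈ admissibleROMs r m p K φ) : (romSystem φ θ).IsRegularStableOn K where
  regularStable := hθ
  E := continuousOn_finsetSum (f := fun i x => φ.e i x • θ.1 i) Finset.univ fun i _ =>
    (hφ.e i).smul continuousOn_const
  A := continuousOn_finsetSum (f := fun i x => φ.a i x • θ.2.1 i) Finset.univ fun i _ =>
    (hφ.a i).smul continuousOn_const
  B := continuousOn_finsetSum (f := fun i x => φ.b i x • θ.2.2.1 i) Finset.univ fun i _ =>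
    (hφ.b i).smul continuousOn_const
  C := continuousOn_finsetSum (f := fun i x => φ.c i x • θ.2.2.2 i) Finset.univ fun i _ =>
    (hφ.c i).smul continuousOn_const

/-- The Frobenius inner product of coefficient tuples. -/
def frobeniusForm (r m p qE qA qB qC : ℕ) :
    ROMCoeffs r m p qE qA qB qC →ₗ[ℝ] ROMCoeffs r m p qE qA qB qC →ₗ[ℝ] ℝ :=
  LinearMap.mk₂ ℝ (fun G H => ∑ i, ((G.1 i)ᵀ * H.1 i).trace + ∑ j, ((G.2.1 j)ᵀ * H.2.1 j).trace +
      ∑ k, ((G.2.2.1 k)ᵀ * H.2.2.1 k).trace + ∑ l, ((G.2.2.2 l)ᵀ * H.2.2.2 l).trace)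
    (fun G G' H => by
      simp only [Prod.fst_add, Prod.snd_add, Pi.add_apply, transpose_add, Matrix.add_mul,
        trace_add, Finset.sum_add_distrib]
      ring)
    (fun c G H => by
      simp only [Prod.smul_fst, Prod.smul_snd, Pi.smul_apply, transpose_smul, Matrix.smul_mul,
        trace_smul, ← Finset.smul_sum, smul_add])
    (fun G H H' => by
      simp only [Prod.fst_add, Prod.snd_add, Pi.add_apply, Matrix.mul_add, trace_add,
        Finset.sum_add_distrib]
      ring)
    (fun c G H => by
      simp only [Prod.smul_fst, Prod.smul_snd, Pi.smul_apply, Matrix.mul_smul, trace_smul,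
        ← Finset.smul_sum, smul_add])

/-- The tuple of integrated slopes of the squared error between `θ` and `θ'`. -/
def slopeTuple (K : Set (Fin d → ℝ)) (S : ParamSystem d n m p)
    (φ : ScalarFunctions d qE qA qB qC) (Qt : (Fin d → ℝ) → Matrix (Fin n) (Fin r) ℝ)
    (Qh : (Fin d → ℝ) → Matrix (Fin r) (Fin r) ℝ) (θ θ' : ROMCoeffs r m p qE qA qB qC) :
    ROMCoeffs r m p qE qA qB qC :=
  (fun i => matrixIntegral K fun x =>
      φ.e i x • slopeE S (romSystem φ θ) (romSystem φ θ') Qt Qh x,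
    fun j => matrixIntegral K fun x =>
      φ.a j x • slopeA S (romSystem φ θ) (romSystem φ θ') Qt Qh x,
    fun k => matrixIntegral K fun x =>
      φ.b k x • slopeB S (romSystem φ θ) (romSystem φ θ') Qt Qh x,
    fun l => matrixIntegral K fun x =>
      φ.c l x • slopeC S (romSystem φ θ) (romSystem φ θ') x)

end Gradient

/-! ### Joint differentiability of the squared error -/

section Gradient

variable {d n r m p qE qA qB qC : ℕ} {K : Set (Fin d → ℝ)} {S : ParamSystem d n m p}
  {φ : ScalarFunctions d qE qA qB qC} {Qt : (Fin d → ℝ) → Matrix (Fin n) (Fin r) ℝ}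
  {Qh : (Fin d → ℝ) → Matrix (Fin r) (Fin r) ℝ} {θ : ROMCoeffs r m p qE qA qB qC}

instance (a b : ℕ) : LocallyCompactSpace (Matrix (Fin a) (Fin b) ℝ) :=
  inferInstanceAs (LocallyCompactSpace (Fin a → Fin b → ℝ))

instance (a b : ℕ) : FirstCountableTopology (Matrix (Fin a) (Fin b) ℝ) :=
  inferInstanceAs (FirstCountableTopology (Fin a → Fin b → ℝ))

lemma continuousOn_slopes (hS : S.IsRegularStableOn K) (hφ : φ.ContinuousOn K)
    (hθ : θ ∈ admissibleROMs r m p K φ) (hQt : ContinuousOn Qt K) (hQh : ContinuousOn Qh K) :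
    ContinuousOn (fun z : (Fin d → ℝ) × ROMCoeffs r m p qE qA qB qC =>
      slopeE S (romSystem φ θ) (romSystem φ z.2) Qt Qh z.1) (K ×ˢ admissibleROMs r m p K φ) ∧
    ContinuousOn (fun z : (Fin d → ℝ) × ROMCoeffs r m p qE qA qB qC =>
      slopeA S (romSystem φ θ) (romSystem φ z.2) Qt Qh z.1) (K ×ˢ admissibleROMs r m p K φ) ∧
    ContinuousOn (fun z : (Fin d → ℝ) × ROMCoeffs r m p qE qA qB qC =>
      slopeB S (romSystem φ θ) (romSystem φ z.2) Qt Qh z.1) (K ×ˢ admissibleROMs r m p K φ) ∧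
    ContinuousOn (fun z : (Fin d → ℝ) × ROMCoeffs r m p qE qA qB qC =>
      slopeC S (romSystem φ θ) (romSystem φ z.2) z.1) (K ×ˢ admissibleROMs r m p K φ) := by
  set Z := K ×ˢ admissibleROMs r m p K φ
  have hZ : Z ⊆ K ×ˢ Set.univ := Set.prod_mono_right (Set.subset_univ _)
  have fst : ∀ {a b : ℕ} {f : (Fin d → ℝ) → Matrix (Fin a) (Fin b) ℝ}, ContinuousOn f K →
      ContinuousOn (fun z : (Fin d → ℝ) × ROMCoeffs r m p qE qA qB qC => f z.1) Z :=
    fun hf => hf.comp continuousOn_fst fun _ hz => hz.1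
  have rE : ContinuousOn (fun z : (Fin d → ℝ) × ROMCoeffs r m p qE qA qB qC =>
      (romSystem φ z.2).E z.1) Z := (continuousOn_sum_smul hφ.e
        (N := fun θ : ROMCoeffs r m p qE qA qB qC => θ.1) (by fun_prop)).mono hZ
  have rA : ContinuousOn (fun z : (Fin d → ℝ) × ROMCoeffs r m p qE qA qB qC =>
      (romSystem φ z.2).A z.1) Z := (continuousOn_sum_smul hφ.a
        (N := fun θ : ROMCoeffs r m p qE qA qB qC => θ.2.1) (by fun_prop)).mono hZ
  have rB : ContinuousOn (fun z : (Fin d → ℝ) × ROMCoeffs r m p qE qA qB qC =>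
      (romSystem φ z.2).B z.1) Z := (continuousOn_sum_smul hφ.b
        (N := fun θ : ROMCoeffs r m p qE qA qB qC => θ.2.2.1) (by fun_prop)).mono hZ
  have rC : ContinuousOn (fun z : (Fin d → ℝ) × ROMCoeffs r m p qE qA qB qC =>
      (romSystem φ z.2).C z.1) Z := (continuousOn_sum_smul hφ.c
        (N := fun θ : ROMCoeffs r m p qE qA qB qC => θ.2.2.2) (by fun_prop)).mono hZ
  have hr : ∀ z ∈ Z, IsRegularStable ((romSystem φ z.2).A z.1) ((romSystem φ z.2).E z.1) :=
    fun z hz => hz.2 z.1 hz.1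
  have Pt : ContinuousOn (fun z : (Fin d → ℝ) × ROMCoeffs r m p qE qA qB qC =>
      ctrlGramian S (romSystem φ z.2) z.1) Z :=
    continuousOn_sylvesterSol (fst hS.A) (fst hS.E) rA rE (continuousOn_matrix_mul (fst hS.B)
      (continuousOn_matrix_transpose rB)) (fun z hz => hS.regularStable z.1 hz.1) hr
  have Ph : ContinuousOn (fun z : (Fin d → ℝ) × ROMCoeffs r m p qE qA qB qC =>
      ctrlGramian (romSystem φ z.2) (romSystem φ z.2) z.1) Z :=
    continuousOn_sylvesterSol rA rE rA rE (continuousOn_matrix_mul rB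
      (continuousOn_matrix_transpose rB)) hr hr
  have hR := isRegularStableOn_romSystem hφ hθ
  have hQhT := continuousOn_matrix_transpose (fst hQh)
  have hQtT := continuousOn_matrix_transpose (fst hQt)
  have hPhT := continuousOn_matrix_transpose Ph
  have mE := continuousOn_matrix_mul (continuousOn_matrix_mul hQtT (fst hS.A)) Pt
  have mA := continuousOn_matrix_mul (continuousOn_matrix_mul hQtT (fst hS.E)) Pt
  have mB := continuousOn_matrix_mul hQtT (fst hS.B)
  have mC := continuousOn_matrix_mul (fst hS.C) Pt
  refine ⟨?_, ?_, ?_, ?_⟩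
  · exact ((continuousOn_matrix_mul (continuousOn_matrix_mul hQhT (fst hR.A)) Ph).add
      (continuousOn_matrix_mul (continuousOn_matrix_mul (fst hQh) rA) hPhT)).add (mE.add mE)
  · exact ((continuousOn_matrix_mul (continuousOn_matrix_mul hQhT (fst hR.E)) Ph).add
      (continuousOn_matrix_mul (continuousOn_matrix_mul (fst hQh) rE) hPhT)).add (mA.add mA)
  · exact ((continuousOn_matrix_mul (fst hQh) rB).add
      (continuousOn_matrix_mul hQhT (fst hR.B))).add (mB.add mB)
  · exact ((continuousOn_matrix_mul rC Ph).add
      (continuousOn_matrix_mul (fst hR.C) hPhT)).sub (mC.add mC)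

lemma continuousAt_slopeTuple (hK : IsCompact K) (hS : S.IsRegularStableOn K)
    (hφ : φ.ContinuousOn K) (hθ : θ ∈ admissibleROMs r m p K φ) (hQt : ContinuousOn Qt K)
    (hQh : ContinuousOn Qh K) : ContinuousAt (slopeTuple K S φ Qt Qh θ) θ := by
  obtain ⟨hE, hA, hB, hC⟩ := continuousOn_slopes hS hφ hθ hQt hQh
  have fst : ∀ {f : (Fin d → ℝ) → ℝ}, ContinuousOn f K →
      ContinuousOn (fun z : (Fin d → ℝ) × ROMCoeffs r m p qE qA qB qC => f z.1)
        (K ×ˢ admissibleROMs r m p K φ) :=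
    fun hf => hf.comp continuousOn_fst fun _ hz => hz.1
  have hU : IsOpen (admissibleROMs r m p K φ) := isOpen_admissibleROMs hK hφ
  refine ContinuousAt.prodMk ?_ (ContinuousAt.prodMk ?_ (ContinuousAt.prodMk ?_ ?_))
  · exact continuousAt_pi.2 fun i => continuousAt_matrixIntegral hK hU ((fst (hφ.e i)).smul hE) hθ
  · exact continuousAt_pi.2 fun i => continuousAt_matrixIntegral hK hU ((fst (hφ.a i)).smul hA) hθ
  · exact continuousAt_pi.2 fun i => continuousAt_matrixIntegral hK hU ((fst (hφ.b i)).smul hB) hθ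
  · exact continuousAt_pi.2 fun i => continuousAt_matrixIntegral hK hU ((fst (hφ.c i)).smul hC) hθ

lemma trace_transpose_mul_sum_sub {q a b : ℕ} (G : Matrix (Fin a) (Fin b) ℝ) (c : Fin q → ℝ)
    (N N' : Fin q → Matrix (Fin a) (Fin b) ℝ) :
    (Gᵀ * (∑ i, c i • N' i - ∑ i, c i • N i)).trace =
      ∑ i, ((c i • G)ᵀ * (N' i - N i)).trace := by
  rw [← Finset.sum_sub_distrib, Matrix.mul_sum, trace_sum]
  refine Finset.sum_congr rfl fun i _ => ?_
  rw [← smul_sub, transpose_smul, Matrix.smul_mul, Matrix.mul_smul]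

lemma integrableOn_trace_sum_smul_sub {q a b : ℕ} (hK : IsCompact K)
    {f : Fin q → (Fin d → ℝ) → ℝ} (hf : ∀ i, ContinuousOn (f i) K)
    {G : (Fin d → ℝ) → Matrix (Fin a) (Fin b) ℝ} (hG : ContinuousOn G K)
    (N N' : Fin q → Matrix (Fin a) (Fin b) ℝ) :
    IntegrableOn (fun x => ((G x)ᵀ * (∑ i, f i x • N' i - ∑ i, f i x • N i)).trace) K := by
  simp only [trace_transpose_mul_sum_sub]
  exact integrable_finsetSum _ fun i _ =>
    integrableOn_trace_transpose_mul hK ((hf i).smul hG) (N' i - N i)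

lemma integral_trace_sum_smul_sub {q a b : ℕ} (hK : IsCompact K)
    {f : Fin q → (Fin d → ℝ) → ℝ} (hf : ∀ i, ContinuousOn (f i) K)
    {G : (Fin d → ℝ) → Matrix (Fin a) (Fin b) ℝ} (hG : ContinuousOn G K)
    (N N' : Fin q → Matrix (Fin a) (Fin b) ℝ) :
    ∫ x in K, ((G x)ᵀ * (∑ i, f i x • N' i - ∑ i, f i x • N i)).trace =
      ∑ i, ((matrixIntegral K fun x => f i x • G x)ᵀ * (N' i - N i)).trace := by
  simp only [trace_transpose_mul_sum_sub]
  exact (integral_finsetSum _ fun i _ =>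
    integrableOn_trace_transpose_mul hK ((hf i).smul hG) (N' i - N i)).trans
    (Finset.sum_congr rfl fun i _ =>
      integral_trace_transpose_mul hK ((hf i).smul hG) (N' i - N i))

lemma integral_add_add_add {X : Type*} [MeasurableSpace X] {μ : Measure X} {f g k l : X → ℝ}
    (hf : Integrable f μ) (hg : Integrable g μ) (hk : Integrable k μ) (hl : Integrable l μ) :
    ∫ x, (f x + g x + k x + l x) ∂μ =
      ∫ x, f x ∂μ + ∫ x, g x ∂μ + ∫ x, k x ∂μ + ∫ x, l x ∂μ := by
  have h1 : Integrable (fun x => f x + g x) μ := hf.add hg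
  have h2 : Integrable (fun x => f x + g x + k x) μ := h1.add hk
  rw [integral_add h2 hl, integral_add h1 hk, integral_add hf hg]

/-- Parameter separability makes each model increment a combination of coefficient increments with
scalar weights, so the pointwise identity integrates to a Frobenius pairing with constant matrices.
-/
lemma sqError_sub (hK : IsCompact K) (hS : S.IsRegularStableOn K) (hφ : φ.ContinuousOn K)
    (hθ : θ ∈ admissibleROMs r m p K φ) (hQt : ContinuousOn Qt K) (hQh : ContinuousOn Qh K)
    (hQt' : ∀ x ∈ K, SolvesObsMixed S (romSystem φ θ) x (Qt x))
    (hQh' : ∀ x ∈ K, SolvesObsReduced (romSystem φ θ) x (Qh x))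
    {θ' : ROMCoeffs r m p qE qA qB qC} (hθ' : θ' ∈ admissibleROMs r m p K φ) :
    sqError K S φ θ' - sqError K S φ θ =
      frobeniusForm r m p qE qA qB qC (slopeTuple K S φ Qt Qh θ θ') (θ' - θ) := by
  have hR := isRegularStableOn_romSystem hφ hθ
  have hR' := isRegularStableOn_romSystem hφ hθ'
  obtain ⟨hE, hA, hB, hC⟩ := continuousOn_slopes hS hφ hθ hQt hQh
  have slice : ∀ {a b : ℕ} {f : (Fin d → ℝ) × ROMCoeffs r m p qE qA qB qC →
      Matrix (Fin a) (Fin b) ℝ}, ContinuousOn f (K ×ˢ admissibleROMs r m p K φ) →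
      ContinuousOn (fun x => f (x, θ')) K :=
    fun hf => hf.comp (by fun_prop) fun x hx => ⟨hx, hθ'⟩
  have e1 : sqError K S φ θ' = ∫ x in K, sqDistAt S (romSystem φ θ') x :=
    toReal_h2l2Error_sq hK hS hR'
  have e2 : sqError K S φ θ = ∫ x in K, sqDistAt S (romSystem φ θ) x :=
    toReal_h2l2Error_sq hK hS hR
  rw [e1, e2, ← integral_sub ((continuousOn_sqDistAt hS hR').integrableOn_compact hK)
    ((continuousOn_sqDistAt hS hR).integrableOn_compact hK)]
  refine (setIntegral_congr_fun hK.measurableSet fun x hx => sqDistAt_sub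
    (hS.regularStable x hx) (hR.regularStable x hx) (hR'.regularStable x hx)
    (hQt' x hx) (hQh' x hx)).trans ?_
  refine (integral_add_add_add
    (integrableOn_trace_sum_smul_sub hK hφ.e (slice hE) θ.1 θ'.1)
    (integrableOn_trace_sum_smul_sub hK hφ.a (slice hA) θ.2.1 θ'.2.1)
    (integrableOn_trace_sum_smul_sub hK hφ.b (slice hB) θ.2.2.1 θ'.2.2.1)
    (integrableOn_trace_sum_smul_sub hK hφ.c (slice hC) θ.2.2.2 θ'.2.2.2)).trans ?_
  rw [integral_trace_sum_smul_sub hK hφ.e (slice hE), integral_trace_sum_smul_sub hK hφ.a (slice hA),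
    integral_trace_sum_smul_sub hK hφ.b (slice hB), integral_trace_sum_smul_sub hK hφ.c (slice hC)]
  rfl

section

-- The entrywise sup norm is only a tool: it induces the product topology, so the derivatives
-- obtained do not depend on it.
attribute [local instance] Matrix.normedAddCommGroup Matrix.normedSpace

lemma hasFDerivAt_sqError (hK : IsCompact K) (hS : S.IsRegularStableOn K)
    (hφ : φ.ContinuousOn K) (hθ : θ ∈ admissibleROMs r m p K φ) (hQt : ContinuousOn Qt K)
    (hQh : ContinuousOn Qh K) (hQt' : ∀ x ∈ K, SolvesObsMixed S (romSystem φ θ) x (Qt x))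
    (hQh' : ∀ x ∈ K, SolvesObsReduced (romSystem φ θ) x (Qh x)) :
    HasFDerivAt (sqError K S φ) (LinearMap.toContinuousLinearMap
      (frobeniusForm r m p qE qA qB qC (slopeTuple K S φ Qt Qh θ θ))) θ := by
  refine hasFDerivAt_of_sub_eq_bilin _ (continuousAt_slopeTuple hK hS hφ hθ hQt hQh) ?_
  filter_upwards [(isOpen_admissibleROMs hK hφ).mem_nhds hθ] with θ' hθ'
  exact sqError_sub hK hS hφ hθ hQt hQh hQt' hQh' hθ'

lemma hasFrobeniusGradientAt_of_hasFDerivAt {a b : ℕ} {f : ROMCoeffs r m p qE qA qB qC → ℝ}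
    {D : ROMCoeffs r m p qE qA qB qC →L[ℝ] ℝ} (hf : HasFDerivAt f D θ)
    (L : Matrix (Fin a) (Fin b) ℝ →ₗ[ℝ] ROMCoeffs r m p qE qA qB qC)
    {g : Matrix (Fin a) (Fin b) ℝ → ℝ} {X₀ G : Matrix (Fin a) (Fin b) ℝ}
    (hg : ∀ X, g X = f (θ + L (X - X₀))) (hG : ∀ H, D (L H) = (Gᵀ * H).trace) :
    HasFrobeniusGradientAt g G X₀ := by
  refine ⟨D ∘L LinearMap.toContinuousLinearMap L, ?_, hG⟩
  rw [funext hg]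
  exact hasFDerivAt_comp_affine hf (LinearMap.toContinuousLinearMap L) X₀

end

lemma update_eq_add_single {q a b : ℕ} (F : Fin q → Matrix (Fin a) (Fin b) ℝ) (i : Fin q)
    (X : Matrix (Fin a) (Fin b) ℝ) : Function.update F i X = F + Pi.single i (X - F i) := by
  ext1 j
  rcases eq_or_ne j i with rfl | h
  · simp
  · simp [h]

lemma sum_trace_transpose_mul_single {q a b : ℕ} (F : Fin q → Matrix (Fin a) (Fin b) ℝ) (i : Fin q)
    (X : Matrix (Fin a) (Fin b) ℝ) :
    ∑ j, ((F j)ᵀ * (Pi.single i X : Fin q → Matrix (Fin a) (Fin b) ℝ) j).trace =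
      ((F i)ᵀ * X).trace := by
  rw [Finset.sum_eq_single i]
  · simp
  · intro j _ hj
    simp [hj]
  · simp

lemma matrixIntegral_smul_congr {a b : ℕ} (hK : IsCompact K) {c : (Fin d → ℝ) → ℝ}
    {M N : (Fin d → ℝ) → Matrix (Fin a) (Fin b) ℝ} (h : ∀ x ∈ K, M x = (2 : ℝ) • N x) :
    matrixIntegral K (fun x => c x • M x) = (2 : ℝ) • matrixIntegral K fun x => c x • N x := by
  ext i j
  simp only [Matrix.smul_apply, smul_eq_mul, matrixIntegral, Matrix.of_apply]
  rw [← integral_const_mul]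
  refine setIntegral_congr_fun hK.measurableSet fun x hx => ?_
  simp only [h x hx, Matrix.smul_apply, smul_eq_mul]
  ring

end Gradient

lemma FOMAssumptions.isRegularStableOn {d n m p : ℕ} {lo hi : Fin d → ℝ} {S : ParamSystem d n m p}
    (hS : FOMAssumptions lo hi S) : S.IsRegularStableOn (Set.Icc lo hi) where
  regularStable x hx := ⟨hS.invertible x hx, hS.stable x hx⟩
  E := hS.continuous_E
  A := hS.continuous_A
  B := hS.continuous_B
  C := hS.continuous_C

end

/-! ### Assembly of the theorem -/

theorem mainTheorem1 {d n r m p qE qA qB qC : ℕ} (lo hi : Fin d → ℝ) (S : ParamSystem d n m p)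
    (hS : FOMAssumptions lo hi S)
    (φ : ScalarFunctions d qE qA qB qC) (hφ : φ.ContinuousOn (Set.Icc lo hi)) :
    -- the set of admissible models is open, so that derivatives on it make sense
    IsOpen (admissibleROMs r m p (Set.Icc lo hi) φ) ∧
    ∀ (Eh : Fin qE → Matrix (Fin r) (Fin r) ℝ) (Ah : Fin qA → Matrix (Fin r) (Fin r) ℝ)
      (Bh : Fin qB → Matrix (Fin r) (Fin m) ℝ) (Ch : Fin qC → Matrix (Fin p) (Fin r) ℝ),
      (Eh, Ah, Bh, Ch) ∈ admissibleROMs r m p (Set.Icc lo hi) φ →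
      -- the error is finite, and the squared error is jointly Fréchet differentiable
      h2l2Error (Set.Icc lo hi) S (romSystem φ (Eh, Ah, Bh, Ch)) ≠ ∞ ∧
      DifferentiableAt ℝ
        (sqError (Set.Icc lo hi) S φ : ROMCoeffs r m p qE qA qB qC → ℝ) (Eh, Ah, Bh, Ch) ∧
      -- the Sylvester and Lyapunov equations are uniquely solvable
      (∀ x ∈ Set.Icc lo hi,
        (∃! X, SolvesCtrlMixed S (romSystem φ (Eh, Ah, Bh, Ch)) x X) ∧
        (∃! X, SolvesCtrlReduced (romSystem φ (Eh, Ah, Bh, Ch)) x X) ∧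
        (∃! X, SolvesObsMixed S (romSystem φ (Eh, Ah, Bh, Ch)) x X) ∧
        (∃! X, SolvesObsReduced (romSystem φ (Eh, Ah, Bh, Ch)) x X)) ∧
      ∀ (Pt Qt : (Fin d → ℝ) → Matrix (Fin n) (Fin r) ℝ)
        (Ph Qh : (Fin d → ℝ) → Matrix (Fin r) (Fin r) ℝ),
        (∀ x ∈ Set.Icc lo hi,
          SolvesCtrlMixed S (romSystem φ (Eh, Ah, Bh, Ch)) x (Pt x) ∧
          SolvesCtrlReduced (romSystem φ (Eh, Ah, Bh, Ch)) x (Ph x) ∧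
          SolvesObsMixed S (romSystem φ (Eh, Ah, Bh, Ch)) x (Qt x) ∧
          SolvesObsReduced (romSystem φ (Eh, Ah, Bh, Ch)) x (Qh x)) →
        -- the blocks depend continuously on the parameter, so the integrals below exist
        (ContinuousOn Pt (Set.Icc lo hi) ∧ ContinuousOn Ph (Set.Icc lo hi) ∧
          ContinuousOn Qt (Set.Icc lo hi) ∧ ContinuousOn Qh (Set.Icc lo hi)) ∧
        -- the gradients
        (∀ i, HasFrobeniusGradientAt
          (fun X => sqError (Set.Icc lo hi) S φ (Function.update Eh i X, Ah, Bh, Ch))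
          ((2 : ℝ) • matrixIntegral (Set.Icc lo hi) fun x => φ.e i x •
            ((Qh x)ᵀ * (romSystem φ (Eh, Ah, Bh, Ch)).A x * Ph x + (Qt x)ᵀ * S.A x * Pt x))
          (Eh i)) ∧
        (∀ j, HasFrobeniusGradientAt
          (fun X => sqError (Set.Icc lo hi) S φ (Eh, Function.update Ah j X, Bh, Ch))
          ((2 : ℝ) • matrixIntegral (Set.Icc lo hi) fun x => φ.a j x •
            ((Qh x)ᵀ * (romSystem φ (Eh, Ah, Bh, Ch)).E x * Ph x + (Qt x)ᵀ * S.E x * Pt x))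
          (Ah j)) ∧
        (∀ k, HasFrobeniusGradientAt
          (fun X => sqError (Set.Icc lo hi) S φ (Eh, Ah, Function.update Bh k X, Ch))
          ((2 : ℝ) • matrixIntegral (Set.Icc lo hi) fun x => φ.b k x •
            ((Qh x)ᵀ * (romSystem φ (Eh, Ah, Bh, Ch)).B x + (Qt x)ᵀ * S.B x))
          (Bh k)) ∧
        (∀ l, HasFrobeniusGradientAt
          (fun X => sqError (Set.Icc lo hi) S φ (Eh, Ah, Bh, Function.update Ch l X))
          ((2 : ℝ) • matrixIntegral (Set.Icc lo hi) fun x => φ.c l x •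
            ((romSystem φ (Eh, Ah, Bh, Ch)).C x * Ph x - S.C x * Pt x))
          (Ch l)) := by
  have hK : IsCompact (Set.Icc lo hi) := isCompact_Icc
  have hSK := hS.isRegularStableOn
  refine ⟨isOpen_admissibleROMs hK hφ, fun Eh Ah Bh Ch hθ => ?_⟩
  set R := romSystem φ (Eh, Ah, Bh, Ch) with hRdef
  have hR : R.IsRegularStableOn (Set.Icc lo hi) := isRegularStableOn_romSystem hφ hθ
  -- The canonical Gramians already give differentiability, before any particular solutions are
  -- supplied.
  have hD := hasFDerivAt_sqError hK hSK hφ hθ (continuousOn_obsGramian hSK hR).neg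
    (continuousOn_obsGramian hR hR)
    (fun x hx => (solvesObsMixed_iff (hSK.regularStable x hx) (hR.regularStable x hx)).2 rfl)
    (fun x hx => (solvesObsReduced_iff (hR.regularStable x hx)).2 rfl)
  refine ⟨h2l2Error_ne_top hK hSK hR, ⟨_, hD⟩, fun x hx => ⟨?_, ?_, ?_, ?_⟩, ?_⟩
  · simp only [solvesCtrlMixed_iff (hSK.regularStable x hx) (hR.regularStable x hx)]
    exact existsUnique_eq
  · simp only [solvesCtrlReduced_iff (hR.regularStable x hx)]
    exact existsUnique_eq
  · simp only [solvesObsMixed_iff (hSK.regularStable x hx) (hR.regularStable x hx)]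
    exact existsUnique_eq
  · simp only [solvesObsReduced_iff (hR.regularStable x hx)]
    exact existsUnique_eq
  intro Pt Qt Ph Qh hsol
  have hPt : Set.EqOn Pt (ctrlGramian S R) (Set.Icc lo hi) := fun x hx =>
    (solvesCtrlMixed_iff (hSK.regularStable x hx) (hR.regularStable x hx)).1 (hsol x hx).1
  have hPh : Set.EqOn Ph (ctrlGramian R R) (Set.Icc lo hi) := fun x hx =>
    (solvesCtrlReduced_iff (hR.regularStable x hx)).1 (hsol x hx).2.1
  have hQt : Set.EqOn Qt (-obsGramian S R) (Set.Icc lo hi) := fun x hx =>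
    (solvesObsMixed_iff (hSK.regularStable x hx) (hR.regularStable x hx)).1 (hsol x hx).2.2.1
  have hQh : Set.EqOn Qh (obsGramian R R) (Set.Icc lo hi) := fun x hx =>
    (solvesObsReduced_iff (hR.regularStable x hx)).1 (hsol x hx).2.2.2
  have hQtc := (continuousOn_obsGramian hSK hR).neg.congr hQt
  have hQhc := (continuousOn_obsGramian hR hR).congr hQh
  -- Symmetry of `Qh` merges the two reduced slope terms of each coefficient into a factor 2.
  have hsymm : ∀ x ∈ Set.Icc lo hi, (Qh x)ᵀ = Qh x := fun x hx => by
    rw [hQh hx, transpose_obsGramian_self (hR.regularStable x hx)]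
  refine ⟨⟨(continuousOn_ctrlGramian hSK hR).congr hPt, (continuousOn_ctrlGramian hR hR).congr hPh,
    hQtc, hQhc⟩, ?_⟩
  -- The same derivative, now expressed with the supplied solutions, which are only known on the
  -- box.
  have hD' := hasFDerivAt_sqError hK hSK hφ hθ hQtc hQhc (fun x hx => (hsol x hx).2.2.1)
    (fun x hx => (hsol x hx).2.2.2)
  refine ⟨fun i => ?_, fun i => ?_, fun i => ?_, fun i => ?_⟩
  · rw [← matrixIntegral_smul_congr hK fun x hx => by
      rw [hPh hx, hPt hx, ← slopeE_self (hR.regularStable x hx) (hsymm x hx)]]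
    -- Replacing one coefficient moves along the inclusion of its slot, so the partial gradient is
    -- the corresponding component of the joint one.
    refine hasFrobeniusGradientAt_of_hasFDerivAt hD' (LinearMap.inl ℝ _ _ ∘ₗ
      LinearMap.single ℝ (fun _ => Matrix (Fin r) (Fin r) ℝ) i) (fun X => ?_) fun H => ?_
    · simp [update_eq_add_single]
    · simpa [frobeniusForm, slopeTuple] using sum_trace_transpose_mul_single
        (slopeTuple (Set.Icc lo hi) S φ Qt Qh (Eh, Ah, Bh, Ch) (Eh, Ah, Bh, Ch)).1 i H
  · rw [← matrixIntegral_smul_congr hK fun x hx => by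
      rw [hPh hx, hPt hx, ← slopeA_self (hR.regularStable x hx) (hsymm x hx)]]
    refine hasFrobeniusGradientAt_of_hasFDerivAt hD' (LinearMap.inr ℝ _ _ ∘ₗ LinearMap.inl ℝ _ _ ∘ₗ
      LinearMap.single ℝ (fun _ => Matrix (Fin r) (Fin r) ℝ) i) (fun X => ?_) fun H => ?_
    · simp [update_eq_add_single]
    · simpa [frobeniusForm, slopeTuple] using sum_trace_transpose_mul_single
        (slopeTuple (Set.Icc lo hi) S φ Qt Qh (Eh, Ah, Bh, Ch) (Eh, Ah, Bh, Ch)).2.1 i H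
  · rw [← matrixIntegral_smul_congr hK fun x hx => by
      rw [← slopeB_self (hsymm x hx)]]
    refine hasFrobeniusGradientAt_of_hasFDerivAt hD' (LinearMap.inr ℝ _ _ ∘ₗ LinearMap.inr ℝ _ _ ∘ₗ
      LinearMap.inl ℝ _ _ ∘ₗ LinearMap.single ℝ (fun _ => Matrix (Fin r) (Fin m) ℝ) i)
      (fun X => ?_) fun H => ?_
    · simp [update_eq_add_single]
    · simpa [frobeniusForm, slopeTuple] using sum_trace_transpose_mul_single
        (slopeTuple (Set.Icc lo hi) S φ Qt Qh (Eh, Ah, Bh, Ch) (Eh, Ah, Bh, Ch)).2.2.1 i H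
  · rw [← matrixIntegral_smul_congr hK fun x hx => by
      rw [hPh hx, hPt hx, ← slopeC_self (hR.regularStable x hx)]]
    refine hasFrobeniusGradientAt_of_hasFDerivAt hD' (LinearMap.inr ℝ _ _ ∘ₗ LinearMap.inr ℝ _ _ ∘ₗ
      LinearMap.inr ℝ _ _ ∘ₗ LinearMap.single ℝ (fun _ => Matrix (Fin p) (Fin r) ℝ) i)
      (fun X => ?_) fun H => ?_
    · simp [update_eq_add_single]
    · simpa [frobeniusForm, slopeTuple] using sum_trace_transpose_mul_single
        (slopeTuple (Set.Icc lo hi) S φ Qt Qh (Eh, Ah, Bh, Ch) (Eh, Ah, Bh, Ch)).2.2.2 i H
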